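/- For $\beta\in\mathbb{C}$ and $n\geq 1$ let $TL_n$ be the Temperley-Lieb algebra: the unital associative $\mathbb{C}$-algebra generated by $u_1,\dots,u_{n-1}$ with relations $u_i^2=\beta u_i$, $u_iu_{i\pm1}u_i=u_i$, and $u_iu_j=u_ju_i$ for $|i-j|>1$. The assignment $u_i\mapsto u_i$ defines a homomorphism $TL_n\to TL_{n+1}$, along which modules are restricted ($\mathrm{Res}$) and induced ($\mathrm{Ind}\,M=TL_{n+1}\otimes_{TL_n}M$). An $(n,p)$-link state consists of points $1,\dots,n$ on a line, of which $2p$ are joined in pairs by $p$ non-crossing arcs (links) drawn on one side of the line, no unlinked point (defect) lying under an arc. The standard module $V_{n,p}$ over $TL_n$ has the $(n,p)$-link states as a $\mathbb{C}$-basis (so $V_{n,p}=0$ if $2p>n$), and $u_i$ acts by concatenation of diagrams: if $i$ and $i+1$ are linked to each other in $d$, then $u_id=\beta d$; if both are defects, then $u_id=0$; otherwise $u_id$ is the link state obtained from $d$ by linking $i$ to $i+1$ and linking the former partners of $i$ and $i+1$ to each other (if only one of $i,i+1$ was linked, its former partner becomes a defect). A link state has a simple link at $i$ if it links $i$ and $i+1$.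 For $1\leq r\leq n+1$, it is $r$-admissible if it has no simple link at any $i\geq r$. Let $\mathcal{S}_{n,p}$ be the family of the elements $u_ru_{r+1}\cdots u_n\otimes d$ of $\mathrm{Ind}\,V_{n,p}$, where $1\leq r\leq n+1$ and $d$ is an $r$-admissible $(n,p)$-link state; for $r=n+1$ the product is $1$, and every $(n,p)$-link state $d$ is allowed. Let $n\geq 1$, $0\leq p\leq\lfloor n/2\rfloor$ and $\beta\in\mathbb{C}$. (i) If $(n,p)\neq(2,1)$ or $\beta\neq 0$, then $\mathcal{S}_{n,p}$ (indexed by the pairs $(r,d)$) is a basis of the complex vector space $\mathrm{Ind}\,V_{n,p}$. If $(n,p)=(2,1)$ and $\beta=0$, then instead the three elements $1\otimes d$, $u_2\otimes d$, $u_1u_2\otimes d$ form a basis of $\mathrm{Ind}\,V_{2,1}$, where $d$ is the unique $(2,1)$-link state. (ii) If $(n,p)\neq(2,1)$ or $\beta\neq 0$, then $\mathrm{Ind}\,V_{n,p}\cong\mathrm{Res}\,V_{n+2,p+1}$ as $TL_{n+1}$-modules. (iii) If $(n,p)\neq(2,1)$ or $\beta\neq 0$, then there is a short exact sequence of $TL_{n+1}$-modules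 $$0\longrightarrow V_{n+1,p+1}\longrightarrow \mathrm{Ind}\,V_{n,p}\longrightarrow V_{n+1,p}\longrightarrow 0 .$$ -/

import Mathlib

set_option linter.unusedSimpArgs false

open scoped TensorProduct

noncomputable section

namespace TemperleyLieb

/-! ### The Temperley-Lieb algebra -/

/-- Indices of the generators `u_1, …, u_{n-1}` of the Temperley-Lieb algebra on `n` points. -/
abbrev Gen (n : ℕ) : Type := {i : ℕ // 1 ≤ i ∧ i < n}

/-- The defining relations of the Temperley-Lieb algebra with loop parameter `β`. -/
inductive Rel (β : ℂ) (n : ℕ) : FreeAlgebra ℂ (Gen n) → FreeAlgebra ℂ (Gen n) → Prop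
  | square (i : Gen n) :
      Rel β n (FreeAlgebra.ι ℂ i * FreeAlgebra.ι ℂ i) (β • FreeAlgebra.ι ℂ i)
  | neighbour (i j : Gen n) (h : j.1 = i.1 + 1 ∨ i.1 = j.1 + 1) :
      Rel β n (FreeAlgebra.ι ℂ i * FreeAlgebra.ι ℂ j * FreeAlgebra.ι ℂ i) (FreeAlgebra.ι ℂ i)
  | distant (i j : Gen n) (h : i.1 + 1 < j.1 ∨ j.1 + 1 < i.1) :
      Rel β n (FreeAlgebra.ι ℂ i * FreeAlgebra.ι ℂ j) (FreeAlgebra.ι ℂ j * FreeAlgebra.ι ℂ i)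

/-- The Temperley-Lieb algebra `TL_n` with parameter `β`: the unital associative complex algebra
generated by `u_1, …, u_{n-1}` subject to `u_i² = β u_i`, `u_i u_{i±1} u_i = u_i` and
`u_i u_j = u_j u_i` for `|i - j| > 1`. -/
abbrev TL (β : ℂ) (n : ℕ) : Type := RingQuot (Rel β n)

/-- The generator `u_i` of `TL_n`. -/
def u (β : ℂ) (n : ℕ) (i : Gen n) : TL β n :=
  RingQuot.mkAlgHom ℂ (Rel β n) (FreeAlgebra.ι ℂ i)

theorem u_square (β : ℂ) (n : ℕ) (i : Gen n) : u β n i * u β n i = β • u β n i := by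
  simpa [u] using RingQuot.mkAlgHom_rel ℂ (Rel.square (β := β) i)

theorem u_neighbour (β : ℂ) (n : ℕ) (i j : Gen n) (h : j.1 = i.1 + 1 ∨ i.1 = j.1 + 1) :
    u β n i * u β n j * u β n i = u β n i := by
  simpa [u] using RingQuot.mkAlgHom_rel ℂ (Rel.neighbour (β := β) i j h)

theorem u_distant (β : ℂ) (n : ℕ) (i j : Gen n) (h : i.1 + 1 < j.1 ∨ j.1 + 1 < i.1) :
    u β n i * u β n j = u β n j * u β n i := by
  simpa [u] using RingQuot.mkAlgHom_rel ℂ (Rel.distant (β := β) i j h)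

/-- Universal property of `TL_n`: elements of a complex algebra that satisfy the Temperley-Lieb
relations define an algebra homomorphism. -/
def liftTL (β : ℂ) (n : ℕ) {A : Type*} [Ring A] [Algebra ℂ A] (f : Gen n → A)
    (h₁ : ∀ i, f i * f i = β • f i)
    (h₂ : ∀ i j : Gen n, (j.1 = i.1 + 1 ∨ i.1 = j.1 + 1) → f i * f j * f i = f i)
    (h₃ : ∀ i j : Gen n, (i.1 + 1 < j.1 ∨ j.1 + 1 < i.1) → f i * f j = f j * f i) :
    TL β n →ₐ[ℂ] A :=
  RingQuot.liftAlgHom ℂ ⟨FreeAlgebra.lift ℂ f, by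
    intro x y h
    cases h with
    | square i => simpa using h₁ i
    | neighbour i j h => simpa using h₂ i j h
    | distant i j h => simpa using h₃ i j h⟩

theorem liftTL_u (β : ℂ) (n : ℕ) {A : Type*} [Ring A] [Algebra ℂ A] (f : Gen n → A)
    (h₁ : ∀ i, f i * f i = β • f i)
    (h₂ : ∀ i j : Gen n, (j.1 = i.1 + 1 ∨ i.1 = j.1 + 1) → f i * f j * f i = f i)
    (h₃ : ∀ i j : Gen n, (i.1 + 1 < j.1 ∨ j.1 + 1 < i.1) → f i * f j = f j * f i) (i : Gen n) :
    liftTL β n f h₁ h₂ h₃ (u β n i) = f i := by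
  simp [liftTL, u]

/-- The homomorphism `TL_n → TL_{n+1}` sending `1` to `1` and `u_i` to `u_i`. -/
def incl (β : ℂ) (n : ℕ) : TL β n →ₐ[ℂ] TL β (n + 1) :=
  liftTL β n (fun i => u β (n + 1) ⟨i.1, i.2.1, Nat.lt_succ_of_lt i.2.2⟩)
    (fun _ => u_square _ _ _) (fun _ _ h => u_neighbour _ _ _ _ h)
    (fun _ _ h => u_distant _ _ _ _ h)

/-! ### Link states -/

/-- An `(n,p)`-link state: `n` marked points `1, …, n`, some of which are joined in pairs by `p`
non-intersecting arcs (links) drawn on one side; the other points are defects, which are connected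
to infinity on that side, so that no defect lies below an arc. `partner` sends a point to the point
it is linked to, and a defect to itself; it is extended by the identity outside `1, …, n`. -/
@[ext]
structure LinkState (n p : ℕ) where
  partner : ℕ → ℕ
  outside : ∀ k, ¬ (1 ≤ k ∧ k ≤ n) → partner k = k
  involutive : ∀ k, partner (partner k) = k
  planar : ∀ k l, k < l → l < partner k → partner l ≠ l ∧ k < partner l ∧ partner l < partner k
  card_links : ((Finset.Icc 1 n).filter fun k => k < partner k).card = p

/-- Result of concatenating the diagram `u_i` with the link pattern `f`: the points `i` and `i+1`
become linked to each other, and the points formerly linked to `i` and `i+1` become linked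
to each other (if only one of `i`, `i+1` was linked, its former partner becomes a defect). -/
def cupFun (i : ℕ) (f : ℕ → ℕ) (k : ℕ) : ℕ :=
  if k = i then i + 1
  else if k = i + 1 then i
  else if f k = i then (if f (i + 1) = i + 1 then k else f (i + 1))
  else if f k = i + 1 then (if f i = i then k else f i)
  else f k

theorem two_mul_card_links (n : ℕ) (f : ℕ → ℕ) (ho : ∀ k, ¬ (1 ≤ k ∧ k ≤ n) → f k = k)
    (hi : ∀ k, f (f k) = k) :
    2 * ((Finset.Icc 1 n).filter fun k => k < f k).card =
      ((Finset.Icc 1 n).filter fun k => f k ≠ k).card := by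
  have h1 : ((Finset.Icc 1 n).filter fun k => f k ≠ k) =
      ((Finset.Icc 1 n).filter fun k => k < f k) ∪ ((Finset.Icc 1 n).filter fun k => f k < k) := by
    ext k
    simp only [Finset.mem_filter, Finset.mem_union]
    grind
  have h2 : ((Finset.Icc 1 n).filter fun k => k < f k).card =
      ((Finset.Icc 1 n).filter fun k => f k < k).card := by
    apply Finset.card_bij (fun k _ => f k)
    · intro k hk
      simp only [Finset.mem_filter, Finset.mem_Icc] at hk ⊢
      grind
    · intro a _ b _ h
      rw [← hi a, ← hi b, h]
    · intro k hk
      simp only [Finset.mem_filter, Finset.mem_Icc] at hk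
      refine ⟨f k, ?_, hi k⟩
      simp only [Finset.mem_filter, Finset.mem_Icc]
      grind
  rw [h1, Finset.card_union_of_disjoint, ← h2, two_mul]
  rw [Finset.disjoint_filter]
  intro k _ h h'
  omega

theorem cupFun_card (n i : ℕ) (h₁ : 1 ≤ i) (h₂ : i < n) (f : ℕ → ℕ)
    (ho : ∀ k, ¬ (1 ≤ k ∧ k ≤ n) → f k = k)
    (hi : ∀ k, f (f k) = k) (h : ¬ (f i = i ∧ f (i + 1) = i + 1)) :
    ((Finset.Icc 1 n).filter fun k => cupFun i f k ≠ k).card =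
      ((Finset.Icc 1 n).filter fun k => f k ≠ k).card := by
  by_cases ha : f i = i
  · have hb : f (i + 1) ≠ i + 1 := fun hb => h ⟨ha, hb⟩
    apply Finset.card_bij (fun k _ => if k = i then f (i + 1) else k)
    · intro k hk
      simp only [Finset.mem_filter, Finset.mem_Icc, cupFun] at hk ⊢
      grind
    · intro k hk l hl
      simp only [Finset.mem_filter, Finset.mem_Icc, cupFun] at hk hl
      grind
    · intro k hk
      simp only [Finset.mem_filter, Finset.mem_Icc] at hk
      refine ⟨if k = f (i + 1) then i else k, ?_, ?_⟩
      · simp only [Finset.mem_filter, Finset.mem_Icc, cupFun]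
        grind
      · grind
  · by_cases hb : f (i + 1) = i + 1
    · apply Finset.card_bij (fun k _ => if k = i + 1 then f i else k)
      · intro k hk
        simp only [Finset.mem_filter, Finset.mem_Icc, cupFun] at hk ⊢
        grind
      · intro k hk l hl
        simp only [Finset.mem_filter, Finset.mem_Icc, cupFun] at hk hl
        grind
      · intro k hk
        simp only [Finset.mem_filter, Finset.mem_Icc] at hk
        refine ⟨if k = f i then i + 1 else k, ?_, ?_⟩
        · simp only [Finset.mem_filter, Finset.mem_Icc, cupFun]
          grind
        · grind
    · congr 1
      ext k
      simp only [Finset.mem_filter, Finset.mem_Icc, cupFun]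
      grind

theorem cupFun_planar (i : ℕ) (f : ℕ → ℕ) (hi : ∀ k, f (f k) = k)
    (hp : ∀ k l, k < l → l < f k → f l ≠ l ∧ k < f l ∧ f l < f k)
    (h : ¬ (f i = i ∧ f (i + 1) = i + 1)) (k l : ℕ) (hkl : k < l) (hl : l < cupFun i f k) :
    cupFun i f l ≠ l ∧ k < cupFun i f l ∧ cupFun i f l < cupFun i f k := by
  have hinj : ∀ x y, f x = f y → x = y := fun x y e => by rw [← hi x, ← hi y, e]
  have a1 := hi i
  have a2 := hi (i + 1)
  have a3 := hi k
  have a4 := hi l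
  have hki : k ≠ i := by rintro rfl; simp [cupFun] at hl; omega
  have hki' : k ≠ i + 1 := by rintro rfl; simp [cupFun] at hl; omega
  by_cases hA : f i = i + 1
  · have e : ∀ k, cupFun i f k = f k := by
      intro k; simp only [cupFun]; grind
    rw [e] at hl; rw [e, e]; exact hp k l hkl hl
  by_cases hB : f i = i
  · have hb : i + 1 < f (i + 1) := by grind
    have e : ∀ k, k ≠ i → k ≠ i + 1 → k ≠ f (i + 1) → cupFun i f k = f k := by
      intro k; simp only [cupFun]; grind
    have e1 : cupFun i f i = i + 1 := by simp [cupFun]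
    have e2 : cupFun i f (i + 1) = i := by simp [cupFun]
    have e3 : cupFun i f (f (i + 1)) = f (i + 1) := by simp only [cupFun]; grind
    have hk3 : k ≠ f (i + 1) := by rintro rfl; omega
    rw [e k hki hki' hk3] at hl ⊢
    grind
  by_cases hC : f (i + 1) = i + 1
  · have hb : f i < i := by grind
    have e : ∀ k, k ≠ i → k ≠ i + 1 → k ≠ f i → cupFun i f k = f k := by
      intro k; simp only [cupFun]; grind
    have e1 : cupFun i f i = i + 1 := by simp [cupFun]
    have e2 : cupFun i f (i + 1) = i := by simp [cupFun]
    have e3 : cupFun i f (f i) = f i := by simp only [cupFun]; grind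
    have hk3 : k ≠ f i := by rintro rfl; omega
    rw [e k hki hki' hk3] at hl ⊢
    grind
  · have e : ∀ k, k ≠ i → k ≠ i + 1 → k ≠ f i → k ≠ f (i + 1) → cupFun i f k = f k := by
      intro k; simp only [cupFun]; grind
    have e1 : cupFun i f i = i + 1 := by simp [cupFun]
    have e2 : cupFun i f (i + 1) = i := by simp [cupFun]
    have e3 : cupFun i f (f i) = f (i + 1) := by simp only [cupFun]; grind
    have e4 : cupFun i f (f (i + 1)) = f i := by simp only [cupFun]; grind
    obtain ⟨a, ha⟩ : ∃ a, f i = a := ⟨_, rfl⟩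
    obtain ⟨b, hb⟩ : ∃ b, f (i + 1) = b := ⟨_, rfl⟩
    obtain ⟨g, hg⟩ : ∃ g, cupFun i f = g := ⟨_, rfl⟩
    rw [hg] at hl e1 e2 e3 e4 ⊢
    simp only [hg] at e
    simp only [ha, hb] at h a1 a2 hA hB hC e e3 e4
    have d : (a < i ∧ i + 1 < b) ∨ (b < a ∧ a < i) ∨ (i + 1 < b ∧ b < a) := by grind
    by_cases k1 : k = a
    · rw [k1, e3] at hl ⊢
      have d' : a < i ∧ i + 1 < b := by omega
      clear d
      by_cases l1 : l = i
      · rw [l1]; omega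
      by_cases l2 : l = i + 1
      · rw [l2]; omega
      rw [e l l1 l2 (by omega) (by omega)]
      by_cases l3 : l < i
      · have := hp a l
        omega
      · have := hp (i + 1) l
        omega
    by_cases k2 : k = b
    · rw [k2, e4] at hl ⊢
      have d' : (b < a ∧ a < i) ∨ (i + 1 < b ∧ b < a) := by omega
      clear d
      have t1 : f l ≠ i := fun hh => by have := hinj l _ (hh.trans a1.symm); omega
      have t2 : f l ≠ i + 1 := fun hh => by have := hinj l _ (hh.trans a2.symm); omega
      have t3 : f l ≠ a := fun hh => by have := hinj l _ (hh.trans ha.symm); omega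
      have t4 : f l ≠ b := fun hh => by have := hinj l _ (hh.trans hb.symm); omega
      rw [e l (by omega) (by omega) (by omega) (by omega)]
      rcases d' with d' | d'
      · have := hp b l
        have := hp a (f l)
        omega
      · have := hp i l
        have := hp (i + 1) (f l)
        omega
    rw [e k hki hki' k1 k2] at hl ⊢
    have t1 : f k ≠ i := fun hh => by have := hinj k _ (hh.trans a1.symm); omega
    have t2 : f k ≠ i + 1 := fun hh => by have := hinj k _ (hh.trans a2.symm); omega
    have q1 := hp k i
    have q2 := hp k (i + 1)
    have q5 := hp k l hkl hl
    by_cases l1 : l = i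
    · rw [l1, e1]; rw [l1] at q5 hl hkl; omega
    by_cases l2 : l = i + 1
    · rw [l2, e2]; rw [l2] at q5 hl hkl; omega
    by_cases l3 : l = a
    · rw [l3, e3]; rw [l3] at q5 hl hkl; omega
    by_cases l4 : l = b
    · rw [l4, e4]; rw [l4] at q5 hl hkl; omega
    rw [e l l1 l2 l3 l4]; exact q5

theorem cupFun_up (i : ℕ) (f : ℕ → ℕ) (hinv : ∀ k, f (f k) = k) (h : f i = i + 1) (k : ℕ) :
    cupFun i (cupFun (i + 1) f) k = f k := by
  have a := hinv i
  have b := hinv (i + 1 + 1)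
  have c := hinv k
  rw [h] at a
  have hinj : f k = f (i + 1 + 1) → k = i + 1 + 1 := fun e => by rw [← c, e, b]
  simp only [cupFun]
  by_cases k1 : k = i
  · subst k1; simp [h]
  by_cases k2 : k = i + 1
  · subst k2; simp [a]
  have d1 : f k ≠ i := by grind
  have d2 : f k ≠ i + 1 := by grind
  by_cases k3 : k = i + 1 + 1
  · subst k3; clear hinv; grind
  clear hinv; grind

theorem cupFun_down (i : ℕ) (f : ℕ → ℕ) (hinv : ∀ k, f (f k) = k) (h : f (i + 1) = i + 1 + 1)
    (k : ℕ) : cupFun (i + 1) (cupFun i f) k = f k := by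
  have a := hinv (i + 1)
  have b := hinv i
  have c := hinv k
  rw [h] at a
  have hinj : f k = f i → k = i := fun e => by rw [← c, e, b]
  simp only [cupFun]
  by_cases k1 : k = i + 1
  · subst k1; simp [h]
  by_cases k2 : k = i + 1 + 1
  · subst k2; simp [a]
  have d1 : f k ≠ i + 1 := by grind
  have d2 : f k ≠ i + 1 + 1 := by grind
  by_cases k3 : k = i
  · subst k3; clear hinv; grind
  clear hinv; grind

theorem cupFun_both (i j : ℕ) (hij : i + 1 < j ∨ j + 1 < i) (f : ℕ → ℕ) (hinv : ∀ k, f (f k) = k)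
    (hi : ¬ (f i = i ∧ f (i + 1) = i + 1)) (hj : ¬ (f j = j ∧ f (j + 1) = j + 1))
    (h : cupFun i f j = j ∧ cupFun i f (j + 1) = j + 1) :
    cupFun j f i = i ∧ cupFun j f (i + 1) = i + 1 := by
  have a1 := hinv i
  have a2 := hinv (i + 1)
  have a3 := hinv j
  have a4 := hinv (j + 1)
  have e1 : j ≠ i := by omega
  have e2 : j ≠ i + 1 := by omega
  have e3 : j + 1 ≠ i := by omega
  have e4 : j + 1 ≠ i + 1 := by omega
  have hinj : ∀ x y, f x = f y → x = y := fun x y e => by rw [← hinv x, ← hinv y, e]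
  simp only [cupFun, e1, e2, e3, e4, e1.symm, e2.symm, e3.symm, e4.symm, if_false] at h ⊢
  clear hinv
  grind

theorem cupFun_comm (i j : ℕ) (hij : i + 1 < j ∨ j + 1 < i) (f : ℕ → ℕ) (hinv : ∀ k, f (f k) = k)
    (hi : ¬ (f i = i ∧ f (i + 1) = i + 1)) (hj : ¬ (f j = j ∧ f (j + 1) = j + 1)) (k : ℕ) :
    cupFun j (cupFun i f) k = cupFun i (cupFun j f) k := by
  have a1 := hinv i
  have a2 := hinv (i + 1)
  have a3 := hinv j
  have a4 := hinv (j + 1)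
  have a5 := hinv k
  have e1 : j ≠ i := by omega
  have e2 : j ≠ i + 1 := by omega
  have e3 : j + 1 ≠ i := by omega
  have e4 : j + 1 ≠ i + 1 := by omega
  have hinj : ∀ x y, f x = f y → x = y := fun x y e => by rw [← hinv x, ← hinv y, e]
  by_cases k1 : k = i
  · subst k1; simp [cupFun, e1, e2, e3, e4, e1.symm, e2.symm, e3.symm, e4.symm]
  by_cases k2 : k = i + 1
  · subst k2; simp [cupFun, e1, e2, e3, e4, e1.symm, e2.symm, e3.symm, e4.symm]
  by_cases k3 : k = j
  · subst k3; simp [cupFun, e1, e2, e3, e4, e1.symm, e2.symm, e3.symm, e4.symm]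
  by_cases k4 : k = j + 1
  · subst k4; simp [cupFun, e1, e2, e3, e4, e1.symm, e2.symm, e3.symm, e4.symm]
  simp only [cupFun, e1, e2, e3, e4, e1.symm, e2.symm, e3.symm, e4.symm, if_false, k1, k2, k3, k4]
  by_cases x1 : f k = i
  · have : f i = k := by grind
    clear hinv
    grind
  by_cases x2 : f k = i + 1
  · have : f (i + 1) = k := by grind
    clear hinv
    grind
  by_cases x3 : f k = j
  · have : f j = k := by grind
    clear hinv
    grind
  by_cases x4 : f k = j + 1
  · have : f (j + 1) = k := by grind
    clear hinv
    grind
  simp [x1, x2, x3, x4]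

/-- The link state obtained from `d` by concatenation with `u_i`, when `i` and `i+1` are not both
defects of `d`. -/
def LinkState.cup {n p : ℕ} (i : Gen n) (d : LinkState n p)
    (h : ¬ (d.partner i.1 = i.1 ∧ d.partner (i.1 + 1) = i.1 + 1)) : LinkState n p where
  partner := cupFun i.1 d.partner
  outside := by
    have := d.outside
    have := d.involutive
    have := i.2
    intro k hk
    simp only [cupFun]
    grind
  involutive := by
    have := d.involutive
    intro k
    simp only [cupFun]
    grind
  planar := by
    have h1 := d.involutive
    have h2 := d.planar
    intro k l hkl hl
    exact cupFun_planar i.1 d.partner h1 h2 h k l hkl hl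
  card_links := by
    have ho : ∀ k, ¬ (1 ≤ k ∧ k ≤ n) → cupFun i.1 d.partner k = k := by
      have := d.outside
      have := d.involutive
      have := i.2
      intro k hk
      simp only [cupFun]
      grind
    have hi : ∀ k, cupFun i.1 d.partner (cupFun i.1 d.partner k) = k := by
      have := d.involutive
      intro k
      simp only [cupFun]
      grind
    have e1 := two_mul_card_links n _ ho hi
    have e2 := two_mul_card_links n _ d.outside d.involutive
    rw [cupFun_card n i.1 i.2.1 i.2.2 d.partner d.outside d.involutive h, ← e2, d.card_links] at e1
    omega

/-- The action of `u_i` on an `(n,p)`-link state `d` by concatenation: a closed loop is replaced by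
the factor `β`, and the result is zero if the number of links is not conserved, which happens
exactly when `i` and `i+1` are both defects. -/
def uBasis (β : ℂ) {n p : ℕ} (i : Gen n) (d : LinkState n p) : LinkState n p →₀ ℂ :=
  open Classical in
  if h : d.partner i.1 = i.1 ∧ d.partner (i.1 + 1) = i.1 + 1 then 0
  else Finsupp.single (d.cup i h) (if d.partner i.1 = i.1 + 1 then β else 1)

/-- The linear extension of `uBasis` to the span of the `(n,p)`-link states. -/
def uOp (β : ℂ) (n p : ℕ) (i : Gen n) : Module.End ℂ (LinkState n p →₀ ℂ) :=
  Finsupp.linearCombination ℂ (uBasis β i)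

theorem uOp_single (β : ℂ) {n p : ℕ} (i : Gen n) (d : LinkState n p) (c : ℂ) :
    uOp β n p i (Finsupp.single d c) = c • uBasis β i d := by
  simp [uOp]

theorem uBasis_zero (β : ℂ) {n p : ℕ} (i : Gen n) (d : LinkState n p)
    (h : d.partner i.1 = i.1 ∧ d.partner (i.1 + 1) = i.1 + 1) : uBasis β i d = 0 := by
  simp [uBasis, h]

theorem uBasis_loop (β : ℂ) {n p : ℕ} (i : Gen n) (d : LinkState n p)
    (h : d.partner i.1 = i.1 + 1) : uBasis β i d = Finsupp.single d β := by
  have h' : ¬ (d.partner i.1 = i.1 ∧ d.partner (i.1 + 1) = i.1 + 1) := by omega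
  rw [uBasis, dif_neg h', if_pos h]
  congr 1
  ext k
  have := d.involutive
  simp only [LinkState.cup, cupFun]
  grind

theorem uBasis_one (β : ℂ) {n p : ℕ} (i : Gen n) (d : LinkState n p)
    (h : ¬ (d.partner i.1 = i.1 ∧ d.partner (i.1 + 1) = i.1 + 1)) (h' : d.partner i.1 ≠ i.1 + 1) :
    uBasis β i d = Finsupp.single (d.cup i h) 1 := by
  rw [uBasis, dif_neg h, if_neg h']

theorem uOp_square (β : ℂ) (n p : ℕ) (i : Gen n) :
    uOp β n p i * uOp β n p i = β • uOp β n p i := by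
  refine Finsupp.lhom_ext fun d c => ?_
  simp only [Module.End.mul_apply, LinearMap.smul_apply, uOp_single, map_smul]
  rw [smul_comm β c]
  congr 1
  by_cases h : d.partner i.1 = i.1 ∧ d.partner (i.1 + 1) = i.1 + 1
  · simp [uBasis_zero β i d h]
  · by_cases h' : d.partner i.1 = i.1 + 1
    · simp [uBasis_loop β i d h', uOp_single]
    · rw [uBasis_one β i d h h', uOp_single, uBasis_loop β i (d.cup i h)]
      · simp
      · simp [LinkState.cup, cupFun]

theorem uOp_neighbour_aux (β : ℂ) {n p : ℕ} (i j : Gen n) (hij : j.1 = i.1 + 1 ∨ i.1 = j.1 + 1)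
    (e : LinkState n p) (he : e.partner i.1 = i.1 + 1) (c : ℂ) :
    uOp β n p i (uOp β n p j (Finsupp.single e c)) = Finsupp.single e c := by
  have hinv := e.involutive
  have h1 : ¬ (e.partner j.1 = j.1 ∧ e.partner (j.1 + 1) = j.1 + 1) := by grind
  have h2 : e.partner j.1 ≠ j.1 + 1 := by grind
  rw [uOp_single, uBasis_one β j e h1 h2, map_smul, uOp_single]
  have h3 : ¬ ((e.cup j h1).partner i.1 = i.1 ∧ (e.cup j h1).partner (i.1 + 1) = i.1 + 1) := by
    simp only [LinkState.cup, cupFun]; grind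
  have h4 : (e.cup j h1).partner i.1 ≠ i.1 + 1 := by
    simp only [LinkState.cup, cupFun]; grind
  rw [uBasis_one β i _ h3 h4]
  have h5 : (e.cup j h1).cup i h3 = e := by
    ext k
    simp only [LinkState.cup]
    rcases hij with h | h
    · rw [h]; exact cupFun_up i.1 e.partner hinv he k
    · rw [h] at he ⊢; exact cupFun_down j.1 e.partner hinv he k
  rw [h5]
  simp

theorem uOp_neighbour (β : ℂ) (n p : ℕ) (i j : Gen n) (hij : j.1 = i.1 + 1 ∨ i.1 = j.1 + 1) :
    uOp β n p i * uOp β n p j * uOp β n p i = uOp β n p i := by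
  refine Finsupp.lhom_ext fun d c => ?_
  simp only [Module.End.mul_apply, uOp_single, map_smul]
  congr 1
  by_cases h : d.partner i.1 = i.1 ∧ d.partner (i.1 + 1) = i.1 + 1
  · simp [uBasis_zero β i d h]
  · rw [uBasis, dif_neg h]
    apply uOp_neighbour_aux β i j hij
    simp [LinkState.cup, cupFun]

theorem uOp_distant (β : ℂ) (n p : ℕ) (i j : Gen n) (hij : i.1 + 1 < j.1 ∨ j.1 + 1 < i.1) :
    uOp β n p i * uOp β n p j = uOp β n p j * uOp β n p i := by
  refine Finsupp.lhom_ext fun d c => ?_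
  simp only [Module.End.mul_apply, uOp_single, map_smul]
  congr 1
  have hinv := d.involutive
  by_cases hi : d.partner i.1 = i.1 ∧ d.partner (i.1 + 1) = i.1 + 1
  · rw [uBasis_zero β i d hi, map_zero]
    by_cases hj : d.partner j.1 = j.1 ∧ d.partner (j.1 + 1) = j.1 + 1
    · rw [uBasis_zero β j d hj, map_zero]
    · rw [uBasis, dif_neg hj, uOp_single, uBasis_zero, smul_zero]
      simp only [LinkState.cup, cupFun]
      grind
  by_cases hj : d.partner j.1 = j.1 ∧ d.partner (j.1 + 1) = j.1 + 1
  · rw [uBasis_zero β j d hj, map_zero]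
    rw [uBasis, dif_neg hi, uOp_single, uBasis_zero, smul_zero]
    simp only [LinkState.cup, cupFun]
    grind
  rw [uBasis, uBasis, dif_neg hi, dif_neg hj, uOp_single, uOp_single]
  by_cases hk : (d.cup i hi).partner j.1 = j.1 ∧ (d.cup i hi).partner (j.1 + 1) = j.1 + 1
  · rw [uBasis_zero β j _ hk, uBasis_zero β i, smul_zero, smul_zero]
    exact cupFun_both i.1 j.1 hij d.partner hinv hi hj hk
  have hk' : ¬ ((d.cup j hj).partner i.1 = i.1 ∧ (d.cup j hj).partner (i.1 + 1) = i.1 + 1) := by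
    exact fun h => hk (cupFun_both j.1 i.1 hij.symm d.partner hinv hj hi h)
  have e : (d.cup i hi).cup j hk = (d.cup j hj).cup i hk' := by
    ext k
    exact cupFun_comm i.1 j.1 hij d.partner hinv hi hj k
  rw [uBasis, uBasis, dif_neg hk, dif_neg hk', e, Finsupp.smul_single, Finsupp.smul_single]
  congr 1
  have l1 : d.partner i.1 = i.1 + 1 → (d.cup j hj).partner i.1 = i.1 + 1 := by
    simp only [LinkState.cup, cupFun]; grind
  have l2 : d.partner j.1 = j.1 + 1 → (d.cup i hi).partner j.1 = j.1 + 1 := by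
    simp only [LinkState.cup, cupFun]; grind
  have l3 : (d.cup j hj).partner i.1 = i.1 + 1 → d.partner i.1 ≠ i.1 + 1 →
      d.partner j.1 ≠ j.1 + 1 ∧ (d.cup i hi).partner j.1 = j.1 + 1 := by
    simp only [LinkState.cup, cupFun]; grind
  have l4 : (d.cup i hi).partner j.1 = j.1 + 1 → d.partner j.1 ≠ j.1 + 1 →
      d.partner i.1 ≠ i.1 + 1 ∧ (d.cup j hj).partner i.1 = i.1 + 1 := by
    simp only [LinkState.cup, cupFun]; grind
  simp only [smul_eq_mul]
  split_ifs <;> simp_all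

/-- The representation of `TL_n` on the span of the `(n,p)`-link states. -/
def rep (β : ℂ) (n p : ℕ) : TL β n →ₐ[ℂ] Module.End ℂ (LinkState n p →₀ ℂ) :=
  liftTL β n (uOp β n p) (uOp_square β n p) (uOp_neighbour β n p) (uOp_distant β n p)

/-- The standard module `V_{n,p}` over `TL_n`: the complex vector space with basis the
`(n,p)`-link states (it is zero if there are none, i.e. if `2p > n`), on which `TL_n` acts by
concatenation if the number of links is conserved, and by zero otherwise. -/
def StdModule (_β : ℂ) (n p : ℕ) : Type := LinkState n p →₀ ℂ

instance (β : ℂ) (n p : ℕ) : AddCommGroup (StdModule β n p) :=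
  inferInstanceAs (AddCommGroup (LinkState n p →₀ ℂ))

instance (β : ℂ) (n p : ℕ) : Module ℂ (StdModule β n p) :=
  inferInstanceAs (Module ℂ (LinkState n p →₀ ℂ))

instance (β : ℂ) (n p : ℕ) : Module (TL β n) (StdModule β n p) :=
  Module.compHom (LinkState n p →₀ ℂ) (rep β n p).toRingHom

/-- A link state, as an element of the standard module. -/
def LinkState.toStd (β : ℂ) {n p : ℕ} (d : LinkState n p) : StdModule β n p :=
  (Finsupp.single d 1 : LinkState n p →₀ ℂ)

theorem TL_smul_eq (β : ℂ) (n p : ℕ) (a : TL β n) (x : StdModule β n p) :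
    a • x = rep β n p a x := rfl

theorem u_smul_toStd (β : ℂ) {n p : ℕ} (i : Gen n) (d : LinkState n p) :
    u β n i • d.toStd β = uBasis β i d := by
  rw [TL_smul_eq, rep, liftTL_u, LinkState.toStd, uOp_single, one_smul]

instance (β : ℂ) (n p : ℕ) : IsScalarTower ℂ (TL β n) (StdModule β n p) where
  smul_assoc c a x := by
    rw [TL_smul_eq, TL_smul_eq, map_smul]
    rfl

/-! ### Induction and restriction -/

/-- For an algebra homomorphism `φ : B → A` and a left `B`-module `M`, the `A`-submodule of
`A ⊗_ℂ M` generated by the elements `a φ(b) ⊗ z - a ⊗ b z`. -/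
def inducedRelations {B A : Type*} [Ring B] [Algebra ℂ B] [Ring A] [Algebra ℂ A]
    (φ : B →ₐ[ℂ] A) (M : Type*) [AddCommGroup M] [Module ℂ M] [Module B M] :
    Submodule A (A ⊗[ℂ] M) :=
  Submodule.span A {x | ∃ (a : A) (b : B) (z : M), x = (a * φ b) ⊗ₜ[ℂ] z - a ⊗ₜ[ℂ] (b • z)}

/-- The induced module `A ⊗_B M`, where `A` is a right `B`-module via `φ : B → A`. -/
abbrev Induced {B A : Type*} [Ring B] [Algebra ℂ B] [Ring A] [Algebra ℂ A]
    (φ : B →ₐ[ℂ] A) (M : Type*) [AddCommGroup M] [Module ℂ M] [Module B M] : Type _ :=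
  (A ⊗[ℂ] M) ⧸ inducedRelations φ M

/-- The element `a ⊗ z` of the induced module `A ⊗_B M`. -/
def Induced.tmul {B A : Type*} [Ring B] [Algebra ℂ B] [Ring A] [Algebra ℂ A]
    (φ : B →ₐ[ℂ] A) {M : Type*} [AddCommGroup M] [Module ℂ M] [Module B M] (a : A) (z : M) :
    Induced φ M :=
  Submodule.Quotient.mk (a ⊗ₜ[ℂ] z)

/-- The restriction along `φ : B → A` of an `A`-module `N`: the same vector space, on which
`b` acts as `φ(b)`. -/
def Restricted {B A : Type*} [Ring B] [Algebra ℂ B] [Ring A] [Algebra ℂ A]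
    (_φ : B →ₐ[ℂ] A) (N : Type*) : Type _ := N

instance {B A : Type*} [Ring B] [Algebra ℂ B] [Ring A] [Algebra ℂ A]
    (φ : B →ₐ[ℂ] A) (N : Type*) [AddCommGroup N] : AddCommGroup (Restricted φ N) :=
  inferInstanceAs (AddCommGroup N)

instance {B A : Type*} [Ring B] [Algebra ℂ B] [Ring A] [Algebra ℂ A]
    (φ : B →ₐ[ℂ] A) (N : Type*) [AddCommGroup N] [Module A N] : Module B (Restricted φ N) :=
  Module.compHom N φ.toRingHom

/-- The `TL_{n+1}`-module `Ind V_{n,p} = TL_{n+1} ⊗_{TL_n} V_{n,p}`. -/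
abbrev Ind (β : ℂ) (n p : ℕ) : Type := Induced (incl β n) (StdModule β n p)

/-- The `TL_{n+1}`-module `Res V_{n+2,p}`, the restriction of the `TL_{n+2}`-module `V_{n+2,p}`. -/
abbrev Res (β : ℂ) (n p : ℕ) : Type := Restricted (incl β (n + 1)) (StdModule β (n + 2) p)

/-! ### The set `S_{n,p}` -/

/-- A link state has a simple link at `i` if it links `i` and `i + 1`. -/
def LinkState.HasSimpleLinkAt {n p : ℕ} (d : LinkState n p) (i : ℕ) : Prop :=
  d.partner i = i + 1

/-- A link state is `r`-admissible if it has no simple link at any `i ≥ r`. -/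
def LinkState.IsAdmissible {n p : ℕ} (r : ℕ) (d : LinkState n p) : Prop :=
  ∀ i, r ≤ i → ¬ d.HasSimpleLinkAt i

/-- The element `u_r u_{r+1} ⋯ u_n` of `TL_{n+1}`, for `1 ≤ r ≤ n+1`; it is `1` for `r = n+1`. -/
def uChain (β : ℂ) (n r : ℕ) (hr : 1 ≤ r) : TL β (n + 1) :=
  (List.ofFn fun k : Fin (n + 1 - r) =>
    u β (n + 1) ⟨r + k, by have := k.2; omega⟩).prod

/-- Index set of `S_{n,p}`: pairs `(r, d)` with `1 ≤ r ≤ n + 1` and `d` an `r`-admissible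
`(n,p)`-link state (every `(n,p)`-link state is `n`- and `(n+1)`-admissible). -/
structure AdmissiblePair (n p : ℕ) where
  r : ℕ
  d : LinkState n p
  one_le : 1 ≤ r
  le : r ≤ n + 1
  admissible : d.IsAdmissible r

/-- The admissible elements `u_r u_{r+1} ⋯ u_n ⊗ d` of `Ind V_{n,p}`, including `1 ⊗ d`
for all `d`, as the case `r = n + 1`; these are the elements of `S_{n,p}`. -/
def admissibleElement (β : ℂ) {n p : ℕ} (x : AdmissiblePair n p) : Ind β n p :=
  Induced.tmul (incl β n) (uChain β n x.r x.one_le) (x.d.toStd β)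

/-- The unique `(2,1)`-link state, which links the points `1` and `2`. -/
def arc : LinkState 2 1 where
  partner k := if k = 1 then 2 else if k = 2 then 1 else k
  outside := by intro k hk; grind
  involutive := by intro k; grind
  planar := by intro k l; grind
  card_links := by decide

end TemperleyLieb

end

noncomputable section

namespace TemperleyLieb

/-! ### Generators of the Temperley-Lieb algebra and linear maps -/

/-! The chains `u_r ⋯ u_n` with `1 ≤ r ≤ n + 1` generate `TL_{n+1}` as a right `TL_n`-module:
multiplying a chain on the left by a generator gives a chain times an element of `TL_n`
(`u_mul_uChain`). Hence `Ind M` is spanned by the elements `u_r ⋯ u_n ⊗ z`.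

For `M = V_{n,p}`, suppose that a link state `d` has a simple link at some `i ≥ r`. Then `d = u_i z`
for some `z`. Moving `u_i` across the tensor sign turns `u_r ⋯ u_n u_i` into `u_{i+2} ⋯ u_n x` with
`x` in `TL_n` (`uChain_mul_u`), a shorter chain. By induction the admissible elements span. The only
obstruction is the equation `d = u_i z`, which fails exactly for the arc on two points at `β = 0`.

Independence comes from a geometric model. Adding an arc at `n + 1`, `n + 2` is a `TL_n`-map from
`V_{n,p}` to `V_{n+2,p+1}`, so Frobenius reciprocity gives `indToRes` from `Ind V_{n,p}` to `Res
V_{n+2,p+1}`. The chain `u_r ⋯ u_n` slides the new arc to `r`, `r + 1`, so the admissible element of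
`(r, d)` goes to `d` with a simple link inserted at `r`. Admissibility says that this link is the
rightmost simple one, so each `(n+2,p+1)`-link state arises exactly once
(`AdmissiblePair.insert_bijective`). The admissible elements are therefore independent for every
`β`, and where they span, `indToRes` carries a basis to a basis.

For the exact sequence, `Ind` is replaced by `Res V_{n+2,p+1}`. The point `n + 2` is not moved by
`TL_{n+1}`, so the states in which it is a defect span a copy of `V_{n+1,p+1}`. In the quotient the
point `n + 2` is linked, and deleting it leaves an `(n+1,p)`-link state whose rightmost defect is
its former partner, so nothing is lost.

In the exceptional case `Ind V_{2,1}` has dimension 3, while `V_{4,2}` has dimension 2. There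
independence of the three elements is seen in an explicit module given by 3 by 3 matrices. -/

theorem TL_induction {β : ℂ} {n : ℕ} {P : TL β n → Prop}
    (scalar : ∀ c : ℂ, P (algebraMap ℂ _ c)) (gen : ∀ i, P (u β n i))
    (add : ∀ a b, P a → P b → P (a + b)) (mul : ∀ a b, P a → P b → P (a * b)) (a : TL β n) :
    P a := by
  obtain ⟨w, rfl⟩ := RingQuot.mkAlgHom_surjective ℂ (Rel β n) a
  induction w using FreeAlgebra.induction with
  | grade0 r => rw [AlgHom.commutes]; exact scalar r
  | grade1 x => exact gen x
  | mul a b ha hb => rw [map_mul]; exact mul _ _ ha hb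
  | add a b ha hb => rw [map_add]; exact add _ _ ha hb

theorem incl_u (β : ℂ) (n : ℕ) (i : Gen n) :
    incl β n (u β n i) = u β (n + 1) ⟨i.1, i.2.1, Nat.lt_succ_of_lt i.2.2⟩ :=
  liftTL_u _ _ _ _ _ _ _

/-- The homomorphism `φ` lets one statement serve two purposes: with `incl` it gives the hypothesis
of Frobenius reciprocity, and with `AlgHom.id` it gives linearity over the Temperley-Lieb algebra
itself. -/
theorem map_smul_of_gen {β : ℂ} {n : ℕ} {A M N : Type*} [Ring A] [Algebra ℂ A]
    [AddCommGroup M] [Module ℂ M] [Module (TL β n) M] [IsScalarTower ℂ (TL β n) M]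
    [AddCommGroup N] [Module ℂ N] [Module A N] [IsScalarTower ℂ A N]
    (φ : TL β n →ₐ[ℂ] A) (f : M →ₗ[ℂ] N) (h : ∀ i x, f (u β n i • x) = φ (u β n i) • f x)
    (a : TL β n) : ∀ x, f (a • x) = φ a • f x := by
  induction a using TL_induction with
  | scalar c => intro x; rw [AlgHom.commutes, algebraMap_smul, algebraMap_smul, map_smul]
  | gen i => exact h i
  | add a b ha hb => intro x; rw [add_smul, map_add, map_add, add_smul, ha, hb]
  | mul a b ha hb => intro x; rw [mul_smul, map_mul, mul_smul, ha, hb]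

/-- The link states, as a basis of the standard module. -/
def StdModule.basis (β : ℂ) (n p : ℕ) : Module.Basis (LinkState n p) ℂ (StdModule β n p) :=
  (Finsupp.basisSingleOne : Module.Basis (LinkState n p) ℂ (LinkState n p →₀ ℂ))

theorem StdModule.basis_apply (β : ℂ) {n p : ℕ} (d : LinkState n p) :
    StdModule.basis β n p d = d.toStd β :=
  congr_fun Finsupp.coe_basisSingleOne d

theorem StdModule.map_smul_of_gen {β : ℂ} {n p : ℕ} {A N : Type*} [Ring A] [Algebra ℂ A]
    [AddCommGroup N] [Module ℂ N] [Module A N] [IsScalarTower ℂ A N]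
    (φ : TL β n →ₐ[ℂ] A) (f : StdModule β n p →ₗ[ℂ] N)
    (h : ∀ i (d : LinkState n p), f (u β n i • d.toStd β) = φ (u β n i) • f (d.toStd β))
    (a : TL β n) (x : StdModule β n p) : f (a • x) = φ a • f x := by
  refine TemperleyLieb.map_smul_of_gen φ f (fun i x => ?_) a x
  have : f ∘ₗ Algebra.lsmul ℂ ℂ (StdModule β n p) (u β n i) =
      Algebra.lsmul ℂ ℂ N (φ (u β n i)) ∘ₗ f :=
    (StdModule.basis β n p).ext fun d => by
      rw [StdModule.basis_apply]; exact h i d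
  exact LinearMap.congr_fun this x

theorem u_smul_toStd_zero (β : ℂ) {n p : ℕ} (i : Gen n) (d : LinkState n p)
    (h : d.partner i.1 = i.1 ∧ d.partner (i.1 + 1) = i.1 + 1) : u β n i • d.toStd β = 0 := by
  rw [u_smul_toStd, uBasis_zero β i d h]; rfl

theorem u_smul_toStd_loop (β : ℂ) {n p : ℕ} (i : Gen n) (d : LinkState n p)
    (h : d.partner i.1 = i.1 + 1) : u β n i • d.toStd β = β • d.toStd β := by
  rw [u_smul_toStd, uBasis_loop β i d h]
  exact (Finsupp.smul_single_one d β).symm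

theorem u_smul_toStd_cup (β : ℂ) {n p : ℕ} (i : Gen n) (d : LinkState n p)
    (h : ¬ (d.partner i.1 = i.1 ∧ d.partner (i.1 + 1) = i.1 + 1)) (h' : d.partner i.1 ≠ i.1 + 1) :
    u β n i • d.toStd β = (d.cup i h).toStd β := by
  rw [u_smul_toStd, uBasis_one β i d h h']; rfl

instance Restricted.moduleComplex {B A : Type*} [Ring B] [Algebra ℂ B] [Ring A] [Algebra ℂ A]
    (φ : B →ₐ[ℂ] A) (N : Type*) [AddCommGroup N] [Module ℂ N] : Module ℂ (Restricted φ N) :=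
  inferInstanceAs (Module ℂ N)

instance Restricted.isScalarTower {B A : Type*} [Ring B] [Algebra ℂ B] [Ring A] [Algebra ℂ A]
    (φ : B →ₐ[ℂ] A) (N : Type*) [AddCommGroup N] [Module ℂ N] [Module A N]
    [IsScalarTower ℂ A N] : IsScalarTower ℂ B (Restricted φ N) where
  smul_assoc c b x := by
    change φ (c • b) • (show N from x) = c • (φ b • (show N from x))
    rw [map_smul, smul_assoc]

/-! ### Induced modules -/

section Induced

variable {B A : Type*} [Ring B] [Algebra ℂ B] [Ring A] [Algebra ℂ A] (φ : B →ₐ[ℂ] A)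
  {M : Type*} [AddCommGroup M] [Module ℂ M] [Module B M]

theorem Induced.tmul_smul (a : A) (b : B) (z : M) :
    Induced.tmul φ a (b • z) = Induced.tmul φ (a * φ b) z :=
  ((Submodule.Quotient.eq (inducedRelations φ M)).2
    (Submodule.subset_span ⟨a, b, z, rfl⟩)).symm

theorem Induced.smul_tmul (a b : A) (z : M) :
    a • Induced.tmul φ b z = Induced.tmul φ (a * b) z := rfl

/-- The complex linear map `z ↦ a ⊗ z`. -/
def Induced.tmulHom (M : Type*) [AddCommGroup M] [Module ℂ M] [Module B M] (a : A) :
    M →ₗ[ℂ] Induced φ M :=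
  ((inducedRelations φ M).mkQ.restrictScalars ℂ) ∘ₗ TensorProduct.mk ℂ A M a

theorem Induced.tmulHom_apply (a : A) (z : M) :
    Induced.tmulHom φ M a z = Induced.tmul φ a z := rfl

theorem Induced.span_tmul :
    Submodule.span ℂ {x | ∃ (a : A) (z : M), x = Induced.tmul φ a z} = ⊤ := by
  rw [eq_top_iff]
  rintro x -
  obtain ⟨t, rfl⟩ := Submodule.Quotient.mk_surjective _ x
  induction t using TensorProduct.induction_on with
  | zero => exact Submodule.zero_mem _
  | tmul a z => exact Submodule.subset_span ⟨a, z, rfl⟩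
  | add s t hs ht => exact Submodule.add_mem _ hs ht

/-- Frobenius reciprocity: extension of a `B`-equivariant map to the induced module. -/
def Induced.lift {N : Type*} [AddCommGroup N] [Module ℂ N] [Module A N] [IsScalarTower ℂ A N]
    (f : M →ₗ[ℂ] N) (h : ∀ (b : B) (z : M), f (b • z) = φ b • f z) : Induced φ M →ₗ[A] N :=
  (inducedRelations φ M).liftQ
    (TensorProduct.AlgebraTensorModule.lift (LinearMap.toSpanSingleton A (M →ₗ[ℂ] N) f)) <| by
    rw [inducedRelations, Submodule.span_le]
    rintro _ ⟨a, b, z, rfl⟩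
    simp [h, mul_smul]

theorem Induced.lift_tmul {N : Type*} [AddCommGroup N] [Module ℂ N] [Module A N]
    [IsScalarTower ℂ A N] (f : M →ₗ[ℂ] N) (h : ∀ (b : B) (z : M), f (b • z) = φ b • f z)
    (a : A) (z : M) : Induced.lift φ f h (Induced.tmul φ a z) = a • f z := by
  simp [Induced.lift, Induced.tmul]

end Induced

/-! ### The elements `u_r ⋯ u_n` -/

theorem uChain_top (β : ℂ) (n : ℕ) (h : 1 ≤ n + 1) : uChain β n (n + 1) h = 1 := by
  unfold uChain
  -- The length `n + 1 - (n + 1)` occurs in the type of the family, so it is generalised before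
  -- being replaced by `0`.
  have : ∀ (k : ℕ) (hk : k = 0) (f : Fin k → TL β (n + 1)), (List.ofFn f).prod = 1 := by
    rintro _ rfl f; simp
  exact this _ (by omega) _

theorem uChain_step (β : ℂ) (n r : ℕ) (h₁ : 1 ≤ r) (h₂ : r < n + 1) :
    uChain β n r h₁ = u β (n + 1) ⟨r, h₁, h₂⟩ * uChain β n (r + 1) (Nat.le_add_left 1 r) := by
  unfold uChain
  have key : ∀ (k l : ℕ) (hk : k = l + 1) (f : Fin k → TL β (n + 1)) (g : Fin l → TL β (n + 1)),
      (∀ j : Fin l, f ⟨j + 1, by omega⟩ = g j) →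
      (List.ofFn f).prod = f ⟨0, by omega⟩ * (List.ofFn g).prod := by
    rintro _ l rfl f g hfg
    rw [List.ofFn_succ, List.prod_cons]
    congr 3
    funext j
    exact hfg j
  refine key _ _ (by omega) _ _ fun j => ?_
  congr 2
  simp only
  omega

/-- Downward induction from `n + 1`. -/
theorem chain_induction {n : ℕ} {P : ℕ → Prop} (m : ℕ) (top : P m)
    (step : ∀ r, n ≤ r → r < m → P (r + 1) → P r) (r : ℕ) (hr : n ≤ r) (hm : r ≤ m) : P r :=
  Nat.decreasingInduction' (fun k hk hk' => step k (hr.trans hk') hk) hm top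

/-- All factors of the chain have index at least `i + 2`, so they commute with `u_i`. Moreover `i <
n`, so on the right `u_i` comes from `TL_n` and can cross the tensor sign. -/
theorem u_mul_uChain_comm (β : ℂ) (n i : ℕ) (hi : 1 ≤ i) (r : ℕ) (hir : i + 2 ≤ r)
    (hr : r ≤ n + 1) : u β (n + 1) ⟨i, hi, by omega⟩ * uChain β n r (by omega) =
      uChain β n r (by omega) * incl β n (u β n ⟨i, hi, by omega⟩) := by
  rw [incl_u]
  refine chain_induction (n := i + 2) (P := fun r => ∀ (h : 1 ≤ r),
    u β (n + 1) ⟨i, hi, by omega⟩ * uChain β n r h =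
      uChain β n r h * u β (n + 1) ⟨i, hi, by omega⟩) (n + 1) ?_ ?_ r hir hr _
  · intro h; rw [uChain_top, mul_one, one_mul]
  · intro r h1 h2 ih h
    rw [uChain_step β n r h h2, ← mul_assoc, u_distant _ _ _ ⟨r, h, h2⟩ (Or.inl (by simp only; omega)),
      mul_assoc, ih, mul_assoc]

/-- Commuting `u_i` up to `u_{i-1}` and using `u_i u_{i-1} u_i = u_i` leaves `u_r ⋯ u_{i-2} u_i ⋯
u_n`. The two blocks commute, and the first one lies in `TL_n`. -/
theorem u_mul_uChain_above (β : ℂ) (n i : ℕ) (hi : 1 ≤ i) (hin : i < n + 1) (r : ℕ) (hr : 1 ≤ r)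
    (hri : r + 1 ≤ i) : ∃ x : TL β n, u β (n + 1) ⟨i, hi, hin⟩ * uChain β n r hr =
      uChain β n i hi * incl β n x := by
  obtain ⟨j, rfl⟩ : ∃ j, i = j + 1 := ⟨i - 1, by omega⟩
  refine chain_induction (n := 1) (P := fun r => ∀ (h : 1 ≤ r), ∃ x : TL β n,
    u β (n + 1) ⟨j + 1, hi, hin⟩ * uChain β n r h = uChain β n (j + 1) hi * incl β n x) j ?_ ?_
    r hr (by omega) hr
  · intro h
    refine ⟨1, ?_⟩
    rw [uChain_step β n j h (by omega), uChain_step β n (j + 1) hi hin, map_one, mul_one,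
      ← mul_assoc, ← mul_assoc, u_neighbour _ _ _ _ (Or.inr rfl)]
  · intro r h1 h2 ih h
    obtain ⟨x, hx⟩ := ih (by omega)
    refine ⟨u β n ⟨r, h, by omega⟩ * x, ?_⟩
    rw [uChain_step β n r h (by omega), ← mul_assoc,
      u_distant _ _ _ ⟨r, h, by omega⟩ (Or.inr (by simp only; omega)), mul_assoc, hx, map_mul,
      ← mul_assoc, ← mul_assoc, u_mul_uChain_comm β n r h (j + 1) (by omega) (by omega)]

/-- For `r < i` the chain is cut down to start at `i`; for `r = i` a factor `β` appears; for `r = i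
+ 1` the chain grows by one; for larger `r` the generator passes through. -/
theorem u_mul_uChain (β : ℂ) (n : ℕ) (i : Gen (n + 1)) (r : ℕ) (hr : 1 ≤ r) (hrn : r ≤ n + 1) :
    ∃ (s : ℕ) (hs : 1 ≤ s) (x : TL β n), s ≤ n + 1 ∧
      u β (n + 1) i * uChain β n r hr = uChain β n s hs * incl β n x := by
  obtain ⟨i, hi, hin⟩ := i
  rcases lt_trichotomy r i with h | rfl | h
  · obtain ⟨x, hx⟩ := u_mul_uChain_above β n i hi hin r hr h
    exact ⟨i, hi, x, by omega, hx⟩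
  · refine ⟨r, hr, β • 1, hrn, ?_⟩
    rw [uChain_step β n r hr hin, ← mul_assoc, u_square, map_smul, map_one, smul_mul_assoc,
      mul_smul_comm, mul_one]
  · by_cases h' : r = i + 1
    · subst h'
      exact ⟨i, hi, 1, by omega, by rw [map_one, mul_one, uChain_step β n i hi hin]⟩
    · exact ⟨r, hr, _, hrn, u_mul_uChain_comm β n i hi r (by omega) hrn⟩

/-- Since `u_i` commutes with `u_{i+2} ⋯ u_n`, it reaches `u_i u_{i+1}`, and `u_i u_{i+1} u_i = u_i`
removes the factor `u_{i+1}`. What remains is `u_r ⋯ u_i` times `u_{i+2} ⋯ u_n`; these commute, and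
the first block lies in `TL_n`. For `i = n - 1` the remaining chain is empty. -/
theorem uChain_mul_u (β : ℂ) (n i : ℕ) (hi : 1 ≤ i) (hin : i < n) (r : ℕ) (hr : 1 ≤ r)
    (hri : r ≤ i) : ∃ x : TL β n, uChain β n r hr * incl β n (u β n ⟨i, hi, hin⟩) =
      uChain β n (i + 2) (by omega) * incl β n x := by
  refine chain_induction (n := 1) (P := fun r => ∀ (h : 1 ≤ r), ∃ x : TL β n,
    uChain β n r h * incl β n (u β n ⟨i, hi, hin⟩) =
      uChain β n (i + 2) (by omega) * incl β n x) i ?_ ?_ r hr hri hr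
  · intro h
    refine ⟨u β n ⟨i, hi, hin⟩, ?_⟩
    rw [uChain_step β n i h (by omega), uChain_step β n (i + 1) (by omega) (by omega), mul_assoc,
      mul_assoc, ← u_mul_uChain_comm β n i hi (i + 1 + 1) (by omega) (by omega), ← mul_assoc,
      ← mul_assoc, u_neighbour _ _ _ _ (Or.inl rfl)]
  · intro r h1 h2 ih h
    obtain ⟨x, hx⟩ := ih (by omega)
    refine ⟨u β n ⟨r, h, by omega⟩ * x, ?_⟩
    rw [uChain_step β n r h (by omega), mul_assoc, hx, map_mul, ← mul_assoc, ← mul_assoc,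
      u_mul_uChain_comm β n r h (i + 2) (by omega) (by omega)]

/-- `Ind M` is spanned by the elements `u_r ⋯ u_n ⊗ z`. -/
theorem Induced.span_uChain_tmul (β : ℂ) (n : ℕ) (M : Type*) [AddCommGroup M] [Module ℂ M]
    [Module (TL β n) M] :
    Submodule.span ℂ {x : Induced (incl β n) M | ∃ (r : ℕ) (hr : 1 ≤ r) (z : M), r ≤ n + 1 ∧
      x = Induced.tmul (incl β n) (uChain β n r hr) z} = ⊤ := by
  set S := Submodule.span ℂ {x : Induced (incl β n) M | ∃ (r : ℕ) (hr : 1 ≤ r) (z : M),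
    r ≤ n + 1 ∧ x = Induced.tmul (incl β n) (uChain β n r hr) z} with hS
  have stable : ∀ a : TL β (n + 1), ∀ x ∈ S, a • x ∈ S := by
    intro a
    induction a using TL_induction with
    | scalar c => intro x hx; rw [algebraMap_smul]; exact S.smul_mem c hx
    | gen i =>
      intro x hx
      induction hx using Submodule.span_induction with
      | mem x h =>
        obtain ⟨r, hr, z, hrn, rfl⟩ := h
        obtain ⟨s, hs, y, hsn, e⟩ := u_mul_uChain β n i r hr hrn
        rw [Induced.smul_tmul, e, ← Induced.tmul_smul]
        exact Submodule.subset_span ⟨s, hs, y • z, hsn, rfl⟩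
      | zero => rw [smul_zero]; exact S.zero_mem
      | add x y _ _ hx hy => rw [smul_add]; exact S.add_mem hx hy
      | smul c x _ hx => rw [smul_comm]; exact S.smul_mem c hx
    | add a b ha hb => intro x hx; rw [add_smul]; exact S.add_mem (ha x hx) (hb x hx)
    | mul a b ha hb => intro x hx; rw [mul_smul]; exact ha _ (hb x hx)
  rw [eq_top_iff, ← Induced.span_tmul, Submodule.span_le]
  rintro _ ⟨a, z, rfl⟩
  -- The span is stable under `TL_{n+1}` and contains `1 ⊗ z` as the empty chain, hence it contains
  -- `a • (1 ⊗ z)`.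
  rw [← mul_one a, ← Induced.smul_tmul]
  exact stable a _ (Submodule.subset_span ⟨n + 1, by omega, z, le_rfl, by rw [uChain_top]⟩)

/-! ### Spanning -/

theorem LinkState.links_pos {n p : ℕ} (d : LinkState n p) (k : ℕ) (h : k < d.partner k) :
    0 < p := by
  rw [← d.card_links, Finset.card_pos]
  refine ⟨k, Finset.mem_filter.2 ⟨Finset.mem_Icc.2 ?_, h⟩⟩
  by_contra hk
  rw [d.outside k hk] at h
  omega

theorem LinkState.HasSimpleLinkAt.mem {n p : ℕ} {d : LinkState n p} {i : ℕ}
    (h : d.HasSimpleLinkAt i) : 1 ≤ i ∧ i < n := by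
  have h' : d.partner i = i + 1 := h
  have h1 := d.outside i
  have h2 := d.outside (i + 1)
  have h3 := d.involutive i
  rw [h'] at h1 h3
  omega

/-- A link state with a simple link at `i` lies in the image of `u_i`, except for the arc on two
points at `β = 0`. -/
theorem exists_u_smul_eq_toStd {β : ℂ} {n p : ℕ} (hp : p ≤ n / 2) (h : (n, p) ≠ (2, 1) ∨ β ≠ 0)
    (i : Gen n) (d : LinkState n p) (hd : d.HasSimpleLinkAt i.1) :
    ∃ z : StdModule β n p, u β n i • z = d.toStd β := by
  have hd' : d.partner i.1 = i.1 + 1 := hd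
  by_cases hβ : β = 0
  · have hn : n ≠ 2 := by
      rintro rfl
      have := d.links_pos i.1 (by omega)
      obtain rfl : p = 1 := by omega
      simp [hβ] at h
    -- At `β = 0` the generator `u_i` kills `d`, so the preimage has to be `u_j d` for a neighbour
    -- `j` of `i`, as `u_i u_j d = d`. A neighbour exists once `n ≥ 3`.
    obtain ⟨j, hj⟩ : ∃ j : Gen n, j.1 = i.1 + 1 ∨ i.1 = j.1 + 1 := by
      have h2 := i.2
      by_cases h1 : i.1 = 1
      · exact ⟨⟨i.1 + 1, by omega, by omega⟩, Or.inl rfl⟩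
      · exact ⟨⟨i.1 - 1, by omega, by omega⟩, Or.inr (by simp only; omega)⟩
    refine ⟨u β n j • d.toStd β, ?_⟩
    rw [TL_smul_eq, TL_smul_eq, rep, liftTL_u, liftTL_u]
    exact uOp_neighbour_aux β i j hj d hd' 1
  · refine ⟨β⁻¹ • d.toStd β, ?_⟩
    rw [smul_comm, u_smul_toStd_loop β i d hd', inv_smul_smul₀ hβ]

/-- Induction on the length `n + 1 - r` of the chain: a simple link of `d` at some `i ≥ r` is traded
for a chain that starts at `i + 2`, at the price of an arbitrary second factor. -/
theorem uChain_tmul_mem_span {β : ℂ} {n p : ℕ} (hp : p ≤ n / 2) (h : (n, p) ≠ (2, 1) ∨ β ≠ 0)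
    (r : ℕ) (hr : 1 ≤ r) (hrn : r ≤ n + 1) (z : StdModule β n p) :
    Induced.tmul (incl β n) (uChain β n r hr) z ∈
      Submodule.span ℂ (Set.range (admissibleElement β (n := n) (p := p))) := by
  induction hk : n + 1 - r using Nat.strong_induction_on generalizing r z with
  | _ k ih =>
    -- Membership in the span is a linear condition on `z`, so `z` may be taken to be a link state.
    rw [← Induced.tmulHom_apply]
    rw [← Submodule.mem_comap (f := Induced.tmulHom (incl β n) (StdModule β n p) (uChain β n r hr))]
    revert z
    rw [← Submodule.eq_top_iff', eq_top_iff, ← (StdModule.basis β n p).span_eq, Submodule.span_le]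
    rintro _ ⟨d, rfl⟩
    rw [StdModule.basis_apply, SetLike.mem_coe, Submodule.mem_comap]
    by_cases hd : d.IsAdmissible r
    · exact Submodule.subset_span ⟨⟨r, d, hr, hrn, hd⟩, rfl⟩
    · obtain ⟨i, hri, hi⟩ : ∃ i, r ≤ i ∧ d.HasSimpleLinkAt i := by
        simpa [LinkState.IsAdmissible] using hd
      obtain ⟨hi1, hi2⟩ := hi.mem
      obtain ⟨z, hz⟩ := exists_u_smul_eq_toStd hp h ⟨i, hi1, hi2⟩ d hi
      obtain ⟨x, hx⟩ := uChain_mul_u β n i hi1 hi2 r hr hri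
      rw [← hz, Induced.tmulHom_apply, Induced.tmul_smul, hx, ← Induced.tmul_smul]
      exact ih (n + 1 - (i + 2)) (by omega) (i + 2) _ (by omega) _ rfl

theorem span_admissibleElement {β : ℂ} {n p : ℕ} (hp : p ≤ n / 2)
    (h : (n, p) ≠ (2, 1) ∨ β ≠ 0) :
    Submodule.span ℂ (Set.range (admissibleElement β (n := n) (p := p))) = ⊤ := by
  rw [eq_top_iff, ← Induced.span_uChain_tmul, Submodule.span_le]
  rintro _ ⟨r, hr, z, hrn, rfl⟩
  exact uChain_tmul_mem_span hp h r hr hrn z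

/-! ### Insertion of a simple link -/

/-- The partner function obtained by inserting two new points `r`, `r + 1`, linked to each other. -/
def insertFun (r : ℕ) (f : ℕ → ℕ) (k : ℕ) : ℕ :=
  if k = r then r + 1
  else if k = r + 1 then r
  else if f (if k < r then k else k - 2) < r then f (if k < r then k else k - 2)
  else f (if k < r then k else k - 2) + 2

/-- The partner function obtained by deleting the points `r`, `r + 1`. -/
def removeFun (r : ℕ) (f : ℕ → ℕ) (k : ℕ) : ℕ :=
  if f (if k < r then k else k + 2) < r then f (if k < r then k else k + 2)
  else f (if k < r then k else k + 2) - 2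

theorem removeFun_insertFun (r : ℕ) (f : ℕ → ℕ) (k : ℕ) : removeFun r (insertFun r f) k = f k := by
  simp only [removeFun, insertFun]
  grind

theorem insertFun_removeFun (r : ℕ) (f : ℕ → ℕ) (hi : ∀ k, f (f k) = k) (h : f r = r + 1) (k : ℕ) :
    insertFun r (removeFun r f) k = f k := by
  have h' : f (r + 1) = r := by rw [← h, hi]
  have h1 : f k = r → k = r + 1 := fun e => by rw [← hi k, e, h]
  have h2 : f k = r + 1 → k = r := fun e => by rw [← hi k, e, h']
  simp only [removeFun, insertFun]
  grind

/-- Here and in `removeFun_cases` the truncated subtraction is put in additive form, so that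
planarity becomes linear arithmetic within the reach of `omega`. -/
theorem insertFun_cases (r : ℕ) (f : ℕ → ℕ) (k : ℕ) :
    (k = r ∧ insertFun r f k = r + 1) ∨ (k = r + 1 ∧ insertFun r f k = r) ∨
      ∃ l, ((k < r ∧ k = l) ∨ (r + 2 ≤ k ∧ k = l + 2)) ∧
        ((f l < r ∧ insertFun r f k = f l) ∨ (r ≤ f l ∧ insertFun r f k = f l + 2)) := by
  by_cases h1 : k = r
  · exact Or.inl ⟨h1, by rw [insertFun, if_pos h1]⟩
  by_cases h2 : k = r + 1
  · exact Or.inr (Or.inl ⟨h2, by rw [insertFun, if_neg h1, if_pos h2]⟩)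
  refine Or.inr (Or.inr ⟨if k < r then k else k - 2, by grind, ?_⟩)
  rw [insertFun, if_neg h1, if_neg h2]
  split_ifs <;> omega

theorem removeFun_cases (r : ℕ) (f : ℕ → ℕ) (h₁ : ∀ k, f k = r → k = r + 1)
    (h₂ : ∀ k, f k = r + 1 → k = r) (k : ℕ) :
    ∃ l, ((k < r ∧ l = k) ∨ (r ≤ k ∧ l = k + 2)) ∧
      ((f l < r ∧ removeFun r f k = f l) ∨ (r + 2 ≤ f l ∧ f l = removeFun r f k + 2)) := by
  refine ⟨if k < r then k else k + 2, by grind, ?_⟩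
  have := h₁ (if k < r then k else k + 2)
  have := h₂ (if k < r then k else k + 2)
  rw [removeFun]
  grind

/-- Links are counted by their left ends. The shift past `r`, `r + 1` is increasing, so left ends
stay left ends, and the only new one is `r`. -/
theorem insertFun_card (n r : ℕ) (h₁ : 1 ≤ r) (h₂ : r ≤ n + 1) (f : ℕ → ℕ) :
    ((Finset.Icc 1 (n + 2)).filter fun k => k < insertFun r f k).card =
      ((Finset.Icc 1 n).filter fun k => k < f k).card + 1 := by
  have hinj : Function.Injective fun k => if k < r then k else k + 2 := by
    intro a b h; simp only at h; grind
  have e : ((Finset.Icc 1 (n + 2)).filter fun k => k < insertFun r f k) =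
      insert r (((Finset.Icc 1 n).filter fun k => k < f k).map ⟨_, hinj⟩) := by
    ext k
    simp only [Finset.mem_filter, Finset.mem_Icc, Finset.mem_insert, Finset.mem_map,
      Function.Embedding.coeFn_mk, insertFun]
    constructor
    · intro h
      by_cases hk : k = r
      · exact Or.inl hk
      · refine Or.inr ⟨if k < r then k else k - 2, ?_, ?_⟩ <;> grind
    · rintro (rfl | ⟨l, hl, rfl⟩) <;> grind
  rw [e, Finset.card_insert_of_notMem, Finset.card_map]
  simp only [Finset.mem_map, Function.Embedding.coeFn_mk, not_exists, not_and]
  grind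

/-- The link state obtained from `d` by inserting a simple link at `r`. -/
def LinkState.insertLink {n p : ℕ} (r : ℕ) (h₁ : 1 ≤ r) (h₂ : r ≤ n + 1) (d : LinkState n p) :
    LinkState (n + 2) (p + 1) where
  partner := insertFun r d.partner
  outside := by
    intro k hk
    have := d.outside (k - 2)
    have := d.outside k
    simp only [insertFun]
    grind
  involutive := by
    intro k
    have := d.involutive (k - 2)
    have := d.involutive k
    simp only [insertFun]
    grind
  planar := by
    intro k l hkl hl
    rcases insertFun_cases r d.partner k with h | h | ⟨k', h, h'⟩
    · omega
    · omega
    rcases insertFun_cases r d.partner l with g | g | ⟨l', g, g'⟩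
    · omega
    · omega
    have := d.planar k' l'
    omega
  card_links := by rw [insertFun_card n r h₁ h₂, d.card_links]

/-- The link state obtained from `d` by deleting a simple link at `r`. -/
def LinkState.remove {n p : ℕ} (r : ℕ) (d : LinkState (n + 2) (p + 1))
    (h : d.HasSimpleLinkAt r) : LinkState n p :=
  have hi := d.involutive
  have h' : d.partner r = r + 1 := h
  have h'' : d.partner (r + 1) = r := by rw [← h', hi]
  have hr1 : ∀ k, d.partner k = r → k = r + 1 := fun k e => by rw [← hi k, e, h']
  have hr2 : ∀ k, d.partner k = r + 1 → k = r := fun k e => by rw [← hi k, e, h'']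
  have hr : 1 ≤ r ∧ r ≤ n + 1 := by
    have h1 := d.outside r
    have h2 := d.outside (r + 1)
    omega
  have ho : ∀ k, ¬ (1 ≤ k ∧ k ≤ n) → removeFun r d.partner k = k := by
    intro k hk
    have := d.outside k
    have := d.outside (k + 2)
    simp only [removeFun]
    grind
  { partner := removeFun r d.partner
    outside := ho
    involutive := by
      intro k
      have := hi k
      have := hi (k + 2)
      have := hr1 k
      have := hr2 k
      have := hr1 (k + 2)
      have := hr2 (k + 2)
      simp only [removeFun]
      grind
    planar := by
      intro k l hkl hl
      obtain ⟨k', h, h'⟩ := removeFun_cases r d.partner hr1 hr2 k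
      obtain ⟨l', g, g'⟩ := removeFun_cases r d.partner hr1 hr2 l
      have := d.planar k' l'
      omega
    card_links := by
      have e := insertFun_card n r hr.1 hr.2 (removeFun r d.partner)
      have e' : insertFun r (removeFun r d.partner) = d.partner :=
        funext (insertFun_removeFun r d.partner hi h')
      rw [e', d.card_links] at e
      omega }

theorem LinkState.insertLink_remove {n p : ℕ} (r : ℕ) (d : LinkState (n + 2) (p + 1))
    (h : d.HasSimpleLinkAt r) (h₁ : 1 ≤ r) (h₂ : r ≤ n + 1) :
    (d.remove r h).insertLink r h₁ h₂ = d := by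
  ext k
  exact insertFun_removeFun r d.partner d.involutive h k

theorem LinkState.insertLink_injective {n p : ℕ} (r : ℕ) (h₁ : 1 ≤ r) (h₂ : r ≤ n + 1) :
    Function.Injective (LinkState.insertLink (p := p) r h₁ h₂) := by
  intro d e h
  ext k
  rw [← removeFun_insertFun r d.partner, ← removeFun_insertFun r e.partner]
  exact congrArg (fun x : LinkState (n + 2) (p + 1) => removeFun r x.partner k) h

/-- An innermost arc is simple: under an arc from `k` that is not simple, planarity makes `k + 1`
the left end of a strictly shorter arc. -/
theorem LinkState.exists_simpleLink {n p : ℕ} (d : LinkState n (p + 1)) :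
    ∃ i, d.HasSimpleLinkAt i := by
  have key : ∀ m k, k < d.partner k → d.partner k - k ≤ m → ∃ i, d.HasSimpleLinkAt i := by
    intro m
    induction m with
    | zero => intro k h1 h2; omega
    | succ m ih =>
      intro k h1 h2
      by_cases h : d.partner k = k + 1
      · exact ⟨k, h⟩
      · have := d.planar k (k + 1) (by omega) (by omega)
        exact ih (k + 1) (by omega) (by omega)
  have hpos : 0 < ((Finset.Icc 1 n).filter fun k => k < d.partner k).card := by
    rw [d.card_links]; omega
  obtain ⟨k, hk⟩ := Finset.card_pos.1 hpos
  exact key _ k (Finset.mem_filter.1 hk).2 le_rfl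

theorem LinkState.exists_last_simpleLink {n p : ℕ} (d : LinkState n (p + 1)) :
    ∃ r, d.HasSimpleLinkAt r ∧ ∀ i, r < i → ¬ d.HasSimpleLinkAt i := by
  classical
  obtain ⟨i, hi⟩ := d.exists_simpleLink
  have hb : ∀ j, d.HasSimpleLinkAt j → j ≤ n := by
    intro j hj
    have hj' : d.partner j = j + 1 := hj
    have := d.outside j
    omega
  refine ⟨Nat.findGreatest d.HasSimpleLinkAt n, Nat.findGreatest_spec (hb i hi) hi, ?_⟩
  intro j hj hj'
  exact absurd (Nat.le_findGreatest (hb j hj') hj') (by omega)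

/-- The link state obtained by inserting a simple link at `r` into `d`. -/
def AdmissiblePair.insert {n p : ℕ} (x : AdmissiblePair n p) : LinkState (n + 2) (p + 1) :=
  x.d.insertLink x.r x.one_le x.le

/-- The position `r` is recovered as that of the rightmost simple link, and `d` by deleting this
link. -/
theorem AdmissiblePair.insert_bijective (n p : ℕ) :
    Function.Bijective (AdmissiblePair.insert (n := n) (p := p)) := by
  constructor
  -- If `x.r < y.r`, the common state has a simple link at `y.r`, and `y.r ≥ x.r + 2` because `x.r +
  -- 1` is linked to `x.r`. Deleting the link at `x.r` moves it to `y.r - 2 ≥ x.r`, against the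
  -- admissibility of `x.d`.
  · have key : ∀ x y : AdmissiblePair n p, x.insert = y.insert → ¬ x.r < y.r := by
      intro x y h hlt
      have h1 : insertFun x.r x.d.partner y.r = y.r + 1 := by
        have : (AdmissiblePair.insert x).partner y.r = (AdmissiblePair.insert y).partner y.r := by
          rw [h]
        refine this.trans ?_
        simp [AdmissiblePair.insert, LinkState.insertLink, insertFun]
      have h2 := x.admissible (y.r - 2)
      simp only [LinkState.HasSimpleLinkAt] at h2
      simp only [insertFun] at h1
      grind
    intro x y h
    have hr : x.r = y.r := by
      have := key x y h
      have := key y x h.symm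
      omega
    obtain ⟨r, d, h1, h2, h3⟩ := x
    obtain ⟨s, e, h4, h5, h6⟩ := y
    obtain rfl : r = s := hr
    obtain rfl : d = e := LinkState.insertLink_injective r h1 h2 h
    rfl
  · intro d
    obtain ⟨r, hr, hmax⟩ := d.exists_last_simpleLink
    have hr' : d.partner r = r + 1 := hr
    have h1 := d.outside r
    have h2 := d.outside (r + 1)
    have h3 := d.involutive r
    rw [hr'] at h3
    refine ⟨⟨r, d.remove r hr, by omega, by omega, ?_⟩, d.insertLink_remove r hr _ _⟩
    intro i hi hs
    have h4 := hmax (i + 2) (by omega)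
    have h5 := insertFun_removeFun r d.partner d.involutive hr' (i + 2)
    have hs' : removeFun r d.partner i = i + 1 := hs
    simp only [LinkState.HasSimpleLinkAt] at h4
    apply h4
    rw [← h5, insertFun, if_neg (by omega), if_neg (by omega), if_neg (by omega : ¬ i + 2 < r),
      Nat.add_sub_cancel, hs', if_neg (by omega)]

/-! ### The isomorphism between induction and restriction -/

/-- A link state, as an element of the restriction of the standard module. -/
def LinkState.toRes (β : ℂ) {n p : ℕ} (d : LinkState (n + 2) p) : Res β n p := d.toStd β

/-- The link states, as a basis of the restriction of the standard module. -/
def Res.basis (β : ℂ) (n p : ℕ) : Module.Basis (LinkState (n + 2) p) ℂ (Res β n p) :=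
  StdModule.basis β (n + 2) p

theorem Res.basis_apply (β : ℂ) {n p : ℕ} (d : LinkState (n + 2) p) :
    Res.basis β n p d = d.toRes β :=
  StdModule.basis_apply β d

theorem u_smul_toRes (β : ℂ) {n p : ℕ} (i : Gen (n + 1)) (d : LinkState (n + 2) p) :
    u β (n + 1) i • d.toRes β =
      (show Res β n p from u β (n + 2) ⟨i.1, i.2.1, Nat.lt_succ_of_lt i.2.2⟩ • d.toStd β) := by
  rw [← incl_u]; rfl

theorem u_smul_toRes_zero (β : ℂ) {n p : ℕ} (i : Gen (n + 1)) (d : LinkState (n + 2) p)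
    (h : d.partner i.1 = i.1 ∧ d.partner (i.1 + 1) = i.1 + 1) :
    u β (n + 1) i • d.toRes β = 0 := by
  rw [u_smul_toRes]; exact u_smul_toStd_zero β _ d h

theorem u_smul_toRes_loop (β : ℂ) {n p : ℕ} (i : Gen (n + 1)) (d : LinkState (n + 2) p)
    (h : d.partner i.1 = i.1 + 1) : u β (n + 1) i • d.toRes β = β • d.toRes β := by
  rw [u_smul_toRes]; exact u_smul_toStd_loop β _ d h

theorem u_smul_toRes_cup (β : ℂ) {n p : ℕ} (i : Gen (n + 1)) (d : LinkState (n + 2) p)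
    (h : ¬ (d.partner i.1 = i.1 ∧ d.partner (i.1 + 1) = i.1 + 1)) (h' : d.partner i.1 ≠ i.1 + 1) :
    u β (n + 1) i • d.toRes β =
      (d.cup ⟨i.1, i.2.1, Nat.lt_succ_of_lt i.2.2⟩ h).toRes β := by
  rw [u_smul_toRes]; exact u_smul_toStd_cup β _ d h h'

/-- The linear map that adds two points at the right end, linked to each other. -/
def capMap (β : ℂ) (n p : ℕ) : StdModule β n p →ₗ[ℂ] Res β n (p + 1) :=
  (StdModule.basis β n p).constr ℂ fun d =>
    (d.insertLink (n + 1) (Nat.le_add_left 1 n) le_rfl).toRes β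

theorem capMap_toStd (β : ℂ) {n p : ℕ} (d : LinkState n p) :
    capMap β n p (d.toStd β) = (d.insertLink (n + 1) (Nat.le_add_left 1 n) le_rfl).toRes β := by
  rw [← StdModule.basis_apply]
  exact (StdModule.basis β n p).constr_basis ℂ _ d

theorem insertFun_of_lt {n k : ℕ} (f : ℕ → ℕ) (h : k ≤ n) (h' : f k ≤ n) :
    insertFun (n + 1) f k = f k := by
  simp only [insertFun]; grind

theorem insertFun_of_gt {n k : ℕ} (f : ℕ → ℕ) (ho : ∀ k, n < k → f k = k) (h : n < k) :
    insertFun (n + 1) f k = if k = n + 1 then n + 2 else if k = n + 2 then n + 1 else k := by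
  have := ho (k - 2)
  simp only [insertFun]; grind

theorem LinkState.partner_le {n p : ℕ} (d : LinkState n p) {k : ℕ} (h : k ≤ n) :
    d.partner k ≤ n := by
  have h1 := d.outside (d.partner k)
  have h2 := d.involutive k
  by_contra hk
  rw [h2] at h1
  omega

theorem cupFun_insertFun_last (n i : ℕ) (hi : i < n) (f : ℕ → ℕ) (hf : ∀ k, k ≤ n → f k ≤ n)
    (ho : ∀ k, n < k → f k = k) (k : ℕ) :
    cupFun i (insertFun (n + 1) f) k = insertFun (n + 1) (cupFun i f) k := by
  have h1 := insertFun_of_lt f hi.le (hf i hi.le)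
  have h2 := insertFun_of_lt f hi (hf (i + 1) hi)
  have h3 := hf k
  have h4 := hf (i + 1) hi
  have h5 := hf i hi.le
  by_cases hk : k ≤ n
  · have h6 := insertFun_of_lt f hk (hf k hk)
    have h7 : cupFun i f k ≤ n := by simp only [cupFun]; grind
    rw [insertFun_of_lt _ hk h7]
    simp only [cupFun, h1, h2, h6]
  · have h6 : ∀ k, n < k → cupFun i f k = k := by
      intro k hk
      have := ho k hk
      simp only [cupFun]; grind
    have h7 := insertFun_of_gt f ho (not_le.1 hk)
    rw [insertFun_of_gt _ h6 (not_le.1 hk), ← h7]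
    clear ho hf
    simp only [cupFun]
    grind

/-- The generators of `TL_n` act on the points `1, …, n` only, where the added arc changes nothing.
-/
theorem capMap_smul (β : ℂ) (n p : ℕ) (a : TL β n) (x : StdModule β n p) :
    capMap β n p (a • x) = incl β n a • capMap β n p x := by
  refine StdModule.map_smul_of_gen (incl β n) (capMap β n p) (fun i d => ?_) a x
  have hp : ∀ k, k ≤ n →
      (d.insertLink (n + 1) (Nat.le_add_left 1 n) le_rfl).partner k = d.partner k := fun k hk =>
    insertFun_of_lt d.partner hk (d.partner_le hk)
  have h1 := hp i.1 i.2.2.le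
  have h2 := hp (i.1 + 1) i.2.2
  rw [incl_u, capMap_toStd]
  by_cases h : d.partner i.1 = i.1 ∧ d.partner (i.1 + 1) = i.1 + 1
  · rw [u_smul_toStd_zero β i d h, map_zero, u_smul_toRes_zero]
    exact ⟨h1.trans h.1, h2.trans h.2⟩
  by_cases h' : d.partner i.1 = i.1 + 1
  · rw [u_smul_toStd_loop β i d h', map_smul, capMap_toStd, u_smul_toRes_loop]
    exact h1.trans h'
  rw [u_smul_toStd_cup β i d h h', capMap_toStd, u_smul_toRes_cup]
  · congr 1
    ext k
    exact (cupFun_insertFun_last n i.1 i.2.2 d.partner (fun k => d.partner_le)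
      (fun k hk => d.outside k (by omega)) k).symm
  · rwa [h1, h2]
  · rwa [h1]

/-- The homomorphism `Ind V_{n,p} → Res V_{n+2,p+1}`. -/
def indToRes (β : ℂ) (n p : ℕ) : Ind β n p →ₗ[TL β (n + 1)] Res β n (p + 1) :=
  Induced.lift (incl β n) (capMap β n p) (capMap_smul β n p)

/-- The strand that ended at `r` is passed on to `r + 2`, the former partner of `r + 1`. So `u_r`
slides the simple link one step to the left, and iteration gives the action of the whole chain. -/
theorem cupFun_insertFun (r : ℕ) (f : ℕ → ℕ) (k : ℕ) :
    cupFun r (insertFun (r + 1) f) k = insertFun r f k := by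
  simp only [cupFun, insertFun]
  grind

theorem uChain_smul_insert (β : ℂ) {n p : ℕ} (d : LinkState n p) (r : ℕ) (h₁ : 1 ≤ r)
    (h₂ : r ≤ n + 1) :
    uChain β n r h₁ • (d.insertLink (n + 1) (Nat.le_add_left 1 n) le_rfl).toRes β =
      (d.insertLink r h₁ h₂).toRes β := by
  refine chain_induction (n := 1) (P := fun r => ∀ (h₁ : 1 ≤ r) (h₂ : r ≤ n + 1),
    uChain β n r h₁ • (d.insertLink (n + 1) (Nat.le_add_left 1 n) le_rfl).toRes β =
      (d.insertLink r h₁ h₂).toRes β) (n + 1) ?_ ?_ r h₁ h₂ h₁ h₂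
  · intro h₁ h₂
    rw [uChain_top, one_smul]
  · intro r _ hr ih h₁ h₂
    have e : insertFun (r + 1) d.partner (r + 1) = r + 2 := by simp [insertFun]
    have e' := (d.insertLink (r + 1) (Nat.le_add_left 1 r) hr).involutive (r + 1)
    have e'' : (d.insertLink (r + 1) (Nat.le_add_left 1 r) hr).partner (r + 1) = r + 2 := e
    rw [uChain_step β n r h₁ hr, mul_smul, ih (Nat.le_add_left 1 r) hr, u_smul_toRes_cup]
    · congr 1
      ext k
      exact cupFun_insertFun r d.partner k
    · simp only; omega
    · intro h
      have := (d.insertLink (r + 1) (Nat.le_add_left 1 r) hr).involutive r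
      simp only at h
      rw [h] at this
      omega

theorem indToRes_admissibleElement (β : ℂ) {n p : ℕ} (x : AdmissiblePair n p) :
    indToRes β n p (admissibleElement β x) = x.insert.toRes β := by
  rw [indToRes, admissibleElement, Induced.lift_tmul, capMap_toStd]
  exact uChain_smul_insert β x.d x.r x.one_le x.le

/-- The images under `indToRes` are distinct basis vectors. No case has to be excluded here: the
exception concerns spanning only. -/
theorem linearIndependent_admissibleElement (β : ℂ) (n p : ℕ) :
    LinearIndependent ℂ (admissibleElement β (n := n) (p := p)) := by
  refine LinearIndependent.of_comp ((indToRes β n p).restrictScalars ℂ) ?_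
  have := (Res.basis β n (p + 1)).linearIndependent.comp _
    (AdmissiblePair.insert_bijective n p).injective
  convert this using 1
  funext x
  exact (indToRes_admissibleElement β x).trans (Res.basis_apply β _).symm

/-- The basis `S_{n,p}` of `Ind V_{n,p}`. -/
def Ind.basis {β : ℂ} {n p : ℕ} (hp : p ≤ n / 2) (h : (n, p) ≠ (2, 1) ∨ β ≠ 0) :
    Module.Basis (AdmissiblePair n p) ℂ (Ind β n p) :=
  Module.Basis.mk (linearIndependent_admissibleElement β n p) (span_admissibleElement hp h).ge

theorem Ind.basis_apply {β : ℂ} {n p : ℕ} (hp : p ≤ n / 2) (h : (n, p) ≠ (2, 1) ∨ β ≠ 0)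
    (x : AdmissiblePair n p) : Ind.basis hp h x = admissibleElement β x :=
  Module.Basis.mk_apply _ _ _

theorem indToRes_bijective {β : ℂ} {n p : ℕ} (hp : p ≤ n / 2) (h : (n, p) ≠ (2, 1) ∨ β ≠ 0) :
    Function.Bijective (indToRes β n p) := by
  let e := (Ind.basis hp h).equiv (Res.basis β n (p + 1))
    (Equiv.ofBijective _ (AdmissiblePair.insert_bijective n p))
  have he : e.toLinearMap = (indToRes β n p).restrictScalars ℂ := by
    refine (Ind.basis hp h).ext fun x => ?_
    rw [LinearEquiv.coe_coe, Module.Basis.equiv_apply, Res.basis_apply, Ind.basis_apply]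
    exact (indToRes_admissibleElement β x).symm
  have he' : ⇑e = ⇑(indToRes β n p) := funext fun x => LinearMap.congr_fun he x
  rw [← he']
  exact e.bijective

/-- The isomorphism `Ind V_{n,p} ≅ Res V_{n+2,p+1}`. -/
def indEquivRes {β : ℂ} {n p : ℕ} (hp : p ≤ n / 2) (h : (n, p) ≠ (2, 1) ∨ β ≠ 0) :
    Ind β n p ≃ₗ[TL β (n + 1)] Res β n (p + 1) :=
  LinearEquiv.ofBijective (indToRes β n p) (indToRes_bijective hp h)

/-! ### The exact sequence for the restriction -/

/-- The link state obtained from `d` by adding a defect at the right end. -/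
def LinkState.addDefect {n p : ℕ} (d : LinkState n p) : LinkState (n + 1) p where
  partner := d.partner
  outside := fun k hk => d.outside k (by omega)
  involutive := d.involutive
  planar := d.planar
  card_links := by
    refine Eq.trans (congrArg Finset.card ?_) d.card_links
    ext k
    have := d.outside k
    simp only [Finset.mem_filter, Finset.mem_Icc]
    omega

/-- The link state obtained from `d` by deleting a defect at the right end. -/
def LinkState.removeDefect {n p : ℕ} (d : LinkState (n + 1) p) (h : d.partner (n + 1) = n + 1) :
    LinkState n p where
  partner := d.partner
  outside := by
    intro k hk
    by_cases hk' : k = n + 1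
    · rw [hk', h]
    · exact d.outside k (by omega)
  involutive := d.involutive
  planar := d.planar
  card_links := by
    refine Eq.trans (congrArg Finset.card ?_) d.card_links
    ext k
    simp only [Finset.mem_filter, Finset.mem_Icc]
    grind

/-- The partner function obtained by deleting the point `m`. -/
def cutFun (m : ℕ) (f : ℕ → ℕ) (k : ℕ) : ℕ :=
  if k = m then m else if f k = m then k else f k

/-- The link state obtained from `d` by deleting the last point, which is not a defect. -/
def LinkState.cut {n p : ℕ} (d : LinkState (n + 1) (p + 1)) (h : d.partner (n + 1) ≠ n + 1) :
    LinkState n p where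
  partner := cutFun (n + 1) d.partner
  outside := by
    intro k hk
    have := d.outside k
    simp only [cutFun]
    grind
  involutive := by
    intro k
    have := d.involutive k
    simp only [cutFun]
    grind
  planar := by
    intro k l hkl hl
    have h1 := d.planar k l
    have h2 := d.involutive l
    have h3 := d.involutive k
    have h4 : k ≤ n + 1 → d.partner k ≤ n + 1 := d.partner_le
    have h5 := d.outside k
    simp only [cutFun] at hl ⊢
    grind
  card_links := by
    have h1 := d.partner_le (le_refl (n + 1))
    have h2 := d.outside (d.partner (n + 1))
    have h3 := d.involutive (n + 1)
    have e : ((Finset.Icc 1 (n + 1)).filter fun k => k < d.partner k) =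
        insert (d.partner (n + 1))
          ((Finset.Icc 1 n).filter fun k => k < cutFun (n + 1) d.partner k) := by
      ext k
      have := d.involutive k
      simp only [Finset.mem_filter, Finset.mem_Icc, Finset.mem_insert, cutFun]
      grind
    have e' := d.card_links
    rw [e, Finset.card_insert_of_notMem] at e'
    · omega
    · simp only [cutFun]
      grind

/-- Cutting turns the partner of the last point into a defect, and it is the rightmost one.
Otherwise the defect `e.partner (n + 1)` of the cut of `e` would lie under the last arc of `d`,
hence be linked in the cut of `d`. -/
theorem cutFun_last_eq {n p : ℕ} (d e : LinkState (n + 1) p) (he : e.partner (n + 1) ≠ n + 1)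
    (h : ∀ k, cutFun (n + 1) d.partner k = cutFun (n + 1) e.partner k) :
    ¬ d.partner (n + 1) < e.partner (n + 1) := by
  intro hlt
  have h1 := d.partner_le (le_refl (n + 1))
  have h1' := e.partner_le (le_refl (n + 1))
  have h2 := d.involutive (n + 1)
  have h3 := e.involutive (n + 1)
  have h4 := h (e.partner (n + 1))
  have h5 := d.planar (d.partner (n + 1)) (e.partner (n + 1)) hlt
  have h6 := d.involutive (e.partner (n + 1))
  simp only [cutFun] at h4
  grind

theorem LinkState.cut_injective {n p : ℕ} (d e : LinkState (n + 1) (p + 1))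
    (hd : d.partner (n + 1) ≠ n + 1) (he : e.partner (n + 1) ≠ n + 1)
    (h : d.cut hd = e.cut he) : d = e := by
  have hk : ∀ k, cutFun (n + 1) d.partner k = cutFun (n + 1) e.partner k := fun k =>
    congrArg (fun x : LinkState n p => x.partner k) h
  have h1 := cutFun_last_eq d e he hk
  have h2 := cutFun_last_eq e d hd fun k => (hk k).symm
  have h3 : d.partner (n + 1) = e.partner (n + 1) := by omega
  have h4 := d.involutive (n + 1)
  have h5 := e.involutive (n + 1)
  ext k
  have h6 := hk k
  have h7 := d.involutive k
  have h8 := e.involutive k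
  simp only [cutFun] at h6
  grind

/-- The partner function obtained by linking the defects `m` and `l`. -/
def linkFun (m l : ℕ) (f : ℕ → ℕ) (k : ℕ) : ℕ :=
  if k = m then l else if k = l then m else f k

/-- The link state obtained from `d` by linking its rightmost defect to a new point at the right
end. -/
def LinkState.close {n p : ℕ} (d : LinkState n p) (m : ℕ) (h₁ : 1 ≤ m) (h₂ : m ≤ n)
    (h : d.partner m = m) (hm : ∀ k, m < k → k ≤ n → d.partner k ≠ k) :
    LinkState (n + 1) (p + 1) where
  partner := linkFun m (n + 1) d.partner
  outside := by
    intro k hk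
    have := d.outside k
    simp only [linkFun]
    grind
  involutive := by
    intro k
    have := d.involutive k
    have := d.outside (n + 1)
    simp only [linkFun]
    grind
  planar := by
    intro k l hkl hl
    have h1 := d.planar k l
    -- No arc of `d` passes over the defect `m`, so every arc lies on one side of `m`. Those on the
    -- right end up under the new arc, together with no defect.
    have h2 := d.planar k m
    have h3 := d.planar (d.partner l) m
    have h4 := d.involutive l
    have h5 := hm l
    have h6 : l ≤ n → d.partner l ≤ n := d.partner_le
    have h7 : k ≤ n → d.partner k ≤ n := d.partner_le
    have h8 := d.outside k
    have h9 := d.involutive k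
    simp only [linkFun] at hl ⊢
    clear hm
    grind
  card_links := by
    have e : ((Finset.Icc 1 (n + 1)).filter fun k => k < linkFun m (n + 1) d.partner k) =
        insert m ((Finset.Icc 1 n).filter fun k => k < d.partner k) := by
      ext k
      have := d.outside k
      simp only [Finset.mem_filter, Finset.mem_Icc, Finset.mem_insert, linkFun]
      grind
    rw [e, Finset.card_insert_of_notMem, d.card_links]
    simp [h]

theorem LinkState.exists_last_defect {n p : ℕ} (d : LinkState n p) (hp : 2 * p < n) :
    ∃ m, 1 ≤ m ∧ m ≤ n ∧ d.partner m = m ∧ ∀ k, m < k → k ≤ n → d.partner k ≠ k := by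
  classical
  obtain ⟨i, hi, hi'⟩ : ∃ i ∈ Finset.Icc 1 n, d.partner i = i := by
    by_contra! hall
    have h := two_mul_card_links n d.partner d.outside d.involutive
    rw [d.card_links, Finset.filter_true_of_mem hall, Nat.card_Icc] at h
    omega
  rw [Finset.mem_Icc] at hi
  refine ⟨Nat.findGreatest (fun k => d.partner k = k) n,
    hi.1.trans (Nat.le_findGreatest hi.2 hi'), Nat.findGreatest_le n,
    Nat.findGreatest_spec (P := fun k => d.partner k = k) hi.2 hi', ?_⟩
  intro k hk hkn h
  exact absurd (Nat.le_findGreatest (P := fun k => d.partner k = k) hkn h) (by omega)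

/-- By counting, `e` has a defect. Linking the rightmost one to a new last point covers no other
defect, and cutting undoes it. -/
theorem LinkState.cut_surjective {n p : ℕ} (hp : 2 * p < n) (e : LinkState n p) :
    ∃ (d : LinkState (n + 1) (p + 1)) (h : d.partner (n + 1) ≠ n + 1), d.cut h = e := by
  obtain ⟨m, h₁, h₂, h, hm⟩ := e.exists_last_defect hp
  have hpt : (e.close m h₁ h₂ h hm).partner = linkFun m (n + 1) e.partner := rfl
  refine ⟨e.close m h₁ h₂ h hm, ?_, ?_⟩
  · rw [hpt, linkFun, if_neg (by omega), if_pos rfl]; omega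
  · ext k
    have h1 : k ≤ n → e.partner k ≤ n := e.partner_le
    have h2 := e.outside k
    simp only [LinkState.cut, hpt, cutFun, linkFun]
    clear hpt hm
    grind

/-- The homomorphism `V_{n+1,p} → Res V_{n+2,p}` that adds a defect. -/
def addDefectMap (β : ℂ) (n p : ℕ) : StdModule β (n + 1) p →ₗ[ℂ] Res β n p :=
  (StdModule.basis β (n + 1) p).constr ℂ fun d => d.addDefect.toRes β

theorem addDefectMap_toStd (β : ℂ) {n p : ℕ} (d : LinkState (n + 1) p) :
    addDefectMap β n p (d.toStd β) = d.addDefect.toRes β := by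
  rw [← StdModule.basis_apply]
  exact (StdModule.basis β (n + 1) p).constr_basis ℂ _ d

theorem addDefectMap_smul (β : ℂ) (n p : ℕ) (a : TL β (n + 1)) (x : StdModule β (n + 1) p) :
    addDefectMap β n p (a • x) = a • addDefectMap β n p x := by
  refine StdModule.map_smul_of_gen (AlgHom.id ℂ _) (addDefectMap β n p) (fun i d => ?_) a x
  rw [AlgHom.id_apply, addDefectMap_toStd]
  by_cases h : d.partner i.1 = i.1 ∧ d.partner (i.1 + 1) = i.1 + 1
  · rw [u_smul_toStd_zero β i d h, map_zero, u_smul_toRes_zero β i _ h]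
  by_cases h' : d.partner i.1 = i.1 + 1
  · rw [u_smul_toStd_loop β i d h', map_smul, addDefectMap_toStd, u_smul_toRes_loop β i _ h']
  rw [u_smul_toStd_cup β i d h h', addDefectMap_toStd, u_smul_toRes_cup β i _ h h']
  rfl

open Classical in
/-- The homomorphism `Res V_{n+2,p+1} → V_{n+1,p}` that deletes the last point if it is linked, and
sends link states with a defect at the last point to zero. -/
def cutMap (β : ℂ) (n p : ℕ) : Res β n (p + 1) →ₗ[ℂ] StdModule β (n + 1) p :=
  (Res.basis β n (p + 1)).constr ℂ fun d =>
    if h : d.partner (n + 2) ≠ n + 2 then (d.cut h).toStd β else 0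

theorem cutMap_toRes (β : ℂ) {n p : ℕ} (d : LinkState (n + 2) (p + 1))
    (h : d.partner (n + 2) ≠ n + 2) : cutMap β n p (d.toRes β) = (d.cut h).toStd β := by
  rw [← Res.basis_apply]
  exact ((Res.basis β n (p + 1)).constr_basis ℂ _ d).trans (dif_pos h)

theorem cutMap_toRes_defect (β : ℂ) {n p : ℕ} (d : LinkState (n + 2) (p + 1))
    (h : d.partner (n + 2) = n + 2) : cutMap β n p (d.toRes β) = 0 := by
  rw [← Res.basis_apply]
  exact ((Res.basis β n (p + 1)).constr_basis ℂ _ d).trans (dif_neg (not_not.2 h))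

theorem cutFun_cupFun (m i : ℕ) (him : i + 1 < m) (f : ℕ → ℕ) (hi : ∀ k, f (f k) = k)
    (k : ℕ) : cutFun m (cupFun i f) k = cupFun i (cutFun m f) k := by
  have h1 := hi i
  have h2 := hi (i + 1)
  have h3 := hi k
  have h4 := hi m
  clear hi
  simp only [cutFun, cupFun] at *
  grind

/-- Only `u_i` with `i ≤ n` act, so `n + 2` is neither `i` nor `i + 1`. A defect there is preserved,
and otherwise cutting commutes with concatenation. -/
theorem cutMap_smul (β : ℂ) (n p : ℕ) (a : TL β (n + 1)) (x : Res β n (p + 1)) :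
    cutMap β n p (a • x) = a • cutMap β n p x := by
  refine map_smul_of_gen (AlgHom.id ℂ _) (cutMap β n p) (fun i x => ?_) a x
  suffices cutMap β n p ∘ₗ Algebra.lsmul ℂ ℂ (Res β n (p + 1)) (u β (n + 1) i) =
      Algebra.lsmul ℂ ℂ (StdModule β (n + 1) p) (u β (n + 1) i) ∘ₗ cutMap β n p from
    LinearMap.congr_fun this x
  refine (Res.basis β n (p + 1)).ext fun d => ?_
  rw [Res.basis_apply]
  change cutMap β n p (u β (n + 1) i • d.toRes β) = u β (n + 1) i • cutMap β n p (d.toRes β)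
  obtain ⟨i, hi1, hi2⟩ := i
  by_cases hd : d.partner (n + 2) = n + 2
  · rw [cutMap_toRes_defect β d hd, smul_zero]
    by_cases h : d.partner i = i ∧ d.partner (i + 1) = i + 1
    · rw [u_smul_toRes_zero β _ d h, map_zero]
    by_cases h' : d.partner i = i + 1
    · rw [u_smul_toRes_loop β _ d h', map_smul, cutMap_toRes_defect β d hd, smul_zero]
    rw [u_smul_toRes_cup β _ d h h', cutMap_toRes_defect]
    have h1 := d.involutive i
    have h2 := d.involutive (i + 1)
    simp only [LinkState.cup, cupFun]
    grind
  · rw [cutMap_toRes β d hd]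
    have hpt : (d.cut hd).partner = cutFun (n + 2) d.partner := rfl
    by_cases h : d.partner i = i ∧ d.partner (i + 1) = i + 1
    · rw [u_smul_toRes_zero β _ d h, map_zero, u_smul_toStd_zero]
      rw [hpt]
      simp only [cutFun]
      grind
    by_cases h' : d.partner i = i + 1
    · rw [u_smul_toRes_loop β _ d h', map_smul, cutMap_toRes β d hd, u_smul_toStd_loop]
      rw [hpt]
      simp only [cutFun]
      grind
    have h1 := d.involutive i
    have h2 := d.involutive (i + 1)
    have h3 := d.involutive (n + 2)
    have h4 := d.planar i (i + 1)
    rw [u_smul_toRes_cup β _ d h h']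
    -- The last point turns into a defect only if one of `i`, `i + 1` was linked to it and the other
    -- was a defect. After cutting both are defects, so `u_i` gives zero on the other side as well.
    by_cases hc : (d.cup ⟨i, hi1, Nat.lt_succ_of_lt hi2⟩ h).partner (n + 2) = n + 2
    · rw [cutMap_toRes_defect β _ hc, u_smul_toStd_zero]
      rw [hpt]
      simp only [LinkState.cup, cupFun] at hc
      simp only [cutFun]
      grind
    · rw [cutMap_toRes β _ hc, u_smul_toStd_cup]
      · congr 1
        ext k
        exact cutFun_cupFun (n + 2) i (by omega) d.partner d.involutive k
      · rw [hpt]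
        simp only [LinkState.cup, cupFun] at hc
        simp only [cutFun]
        grind
      · rw [hpt]
        simp only [cutFun]
        grind

/-- A splitting that is only required to be complex linear: `f` deletes a final defect and `g`
undoes a cut. The first identity yields injectivity of `addDefectMap`, the second that the kernel of
`cutMap` lies in its image. -/
theorem addDefectMap_cutMap_split (β : ℂ) (n p : ℕ) :
    ∃ (f : Res β n (p + 1) →ₗ[ℂ] StdModule β (n + 1) (p + 1))
      (g : StdModule β (n + 1) p →ₗ[ℂ] Res β n (p + 1)),
      f ∘ₗ addDefectMap β n (p + 1) = LinearMap.id ∧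
      g ∘ₗ cutMap β n p + addDefectMap β n (p + 1) ∘ₗ f = LinearMap.id := by
  classical
  let f : Res β n (p + 1) →ₗ[ℂ] StdModule β (n + 1) (p + 1) :=
    (Res.basis β n (p + 1)).constr ℂ fun d =>
      if h : d.partner (n + 2) = n + 2 then (d.removeDefect h).toStd β else 0
  -- The value `0` on states that are not cuts is immaterial, as `g` is only evaluated after
  -- `cutMap`. The chosen preimage is unique by `LinkState.cut_injective`.
  let g : StdModule β (n + 1) p →ₗ[ℂ] Res β n (p + 1) :=
    (StdModule.basis β (n + 1) p).constr ℂ fun e =>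
      if h : ∃ (d : LinkState (n + 2) (p + 1)) (hd : d.partner (n + 2) ≠ n + 2), d.cut hd = e
      then h.choose.toRes β else 0
  have hf : ∀ d : LinkState (n + 2) (p + 1), f (d.toRes β) =
      if h : d.partner (n + 2) = n + 2 then (d.removeDefect h).toStd β else 0 := fun d => by
    rw [← Res.basis_apply]
    exact (Res.basis β n (p + 1)).constr_basis ℂ _ d
  have hg : ∀ (d : LinkState (n + 2) (p + 1)) (hd : d.partner (n + 2) ≠ n + 2),
      g ((d.cut hd).toStd β) = d.toRes β := fun d hd => by
    have hex : ∃ (d' : LinkState (n + 2) (p + 1)) (hd' : d'.partner (n + 2) ≠ n + 2),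
      d'.cut hd' = d.cut hd := ⟨d, hd, rfl⟩
    obtain ⟨hd', hc⟩ := hex.choose_spec
    rw [← StdModule.basis_apply]
    refine ((StdModule.basis β (n + 1) p).constr_basis ℂ _ _).trans ((dif_pos hex).trans ?_)
    rw [LinkState.cut_injective _ d hd' hd hc]
  refine ⟨f, g, (StdModule.basis β (n + 1) (p + 1)).ext fun d => ?_,
    (Res.basis β n (p + 1)).ext fun d => ?_⟩
  · rw [StdModule.basis_apply, LinearMap.comp_apply, addDefectMap_toStd, hf,
      dif_pos (show d.addDefect.partner (n + 2) = n + 2 from d.outside (n + 2) (by omega))]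
    rfl
  · rw [Res.basis_apply, LinearMap.add_apply, LinearMap.comp_apply, LinearMap.comp_apply, hf]
    by_cases h : d.partner (n + 2) = n + 2
    · rw [dif_pos h, cutMap_toRes_defect β d h, map_zero, zero_add, addDefectMap_toStd]
      rfl
    · rw [dif_neg h, cutMap_toRes β d h, hg, map_zero, add_zero]
      rfl

theorem addDefectMap_injective (β : ℂ) (n p : ℕ) :
    Function.Injective (addDefectMap β n (p + 1)) := by
  obtain ⟨f, g, hf, -⟩ := addDefectMap_cutMap_split β n p
  exact Function.LeftInverse.injective (g := f) (LinearMap.congr_fun hf)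

theorem cutMap_surjective (β : ℂ) {n p : ℕ} (hp : 2 * p < n + 1) :
    Function.Surjective (cutMap β n p) := by
  rw [← LinearMap.range_eq_top, eq_top_iff, ← (StdModule.basis β (n + 1) p).span_eq,
    Submodule.span_le]
  rintro _ ⟨e, rfl⟩
  obtain ⟨d, h, rfl⟩ := e.cut_surjective hp
  exact ⟨d.toRes β, by rw [cutMap_toRes β d h, StdModule.basis_apply]⟩

theorem exact_addDefectMap_cutMap (β : ℂ) (n p : ℕ) :
    Function.Exact (addDefectMap β n (p + 1)) (cutMap β n p) := by
  obtain ⟨f, g, -, hg⟩ := addDefectMap_cutMap_split β n p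
  intro x
  constructor
  · intro hx
    have := LinearMap.congr_fun hg x
    rw [LinearMap.add_apply, LinearMap.comp_apply, hx, map_zero, zero_add] at this
    exact ⟨f x, this⟩
  · rintro ⟨y, rfl⟩
    have : cutMap β n p ∘ₗ addDefectMap β n (p + 1) = 0 :=
      (StdModule.basis β (n + 1) (p + 1)).ext fun d => by
        rw [StdModule.basis_apply, LinearMap.comp_apply, addDefectMap_toStd]
        exact cutMap_toRes_defect β _ (d.outside (n + 2) (by omega))
    exact LinearMap.congr_fun this y

/-- The short exact sequence `0 → V_{n+1,p+1} → Res V_{n+2,p+1} → V_{n+1,p} → 0`. -/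
theorem exists_exact_res (β : ℂ) {n p : ℕ} (hp : p ≤ n / 2) :
    ∃ (f : StdModule β (n + 1) (p + 1) →ₗ[TL β (n + 1)] Res β n (p + 1))
      (g : Res β n (p + 1) →ₗ[TL β (n + 1)] StdModule β (n + 1) p),
      Function.Injective f ∧ Function.Exact f g ∧ Function.Surjective g :=
  ⟨{ toFun := addDefectMap β n (p + 1), map_add' := map_add _,
     map_smul' := addDefectMap_smul β n (p + 1) },
   { toFun := cutMap β n p, map_add' := map_add _, map_smul' := cutMap_smul β n p },
   addDefectMap_injective β n p, exact_addDefectMap_cutMap β n p,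
   cutMap_surjective β (by omega)⟩

/-! ### The exceptional case -/

theorem LinkState.eq_arc (d : LinkState 2 1) : d = arc := by
  have h : d.partner 1 = 2 := by
    have hpos : 0 < ((Finset.Icc 1 2).filter fun k => k < d.partner k).card := by
      rw [d.card_links]; omega
    obtain ⟨k, hk⟩ := Finset.card_pos.1 hpos
    rw [Finset.mem_filter, Finset.mem_Icc] at hk
    have h1 := d.partner_le hk.1.2
    obtain rfl : k = 1 := by omega
    omega
  have h' : d.partner 2 = 1 := by have := d.involutive 1; rwa [h] at this
  ext k
  have := d.outside k
  simp only [arc]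
  grind

/-- The action of `u_1`, `u_2` in the basis `1 ⊗ d`, `u_2 ⊗ d`, `u_1 u_2 ⊗ d` of `Ind V_{2,1}`
at `β = 0`. -/
def excMatrix (i : Gen (2 + 1)) : Matrix (Fin 3) (Fin 3) ℂ :=
  if i.1 = 1 then !![0, 0, 0; 0, 0, 0; 0, 1, 0] else !![0, 0, 0; 1, 0, 1; 0, 0, 0]

theorem Gen.eq_one_or_two (i : Gen (2 + 1)) : i.1 = 1 ∨ i.1 = 2 := by
  have := i.2
  omega

/-- The three-dimensional representation of `TL_3` at `β = 0` given by `excMatrix`. -/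
def excRep : TL 0 (2 + 1) →ₐ[ℂ] Module.End ℂ (Fin 3 → ℂ) :=
  (Matrix.toLinAlgEquiv' : Matrix (Fin 3) (Fin 3) ℂ ≃ₐ[ℂ] _).toAlgHom.comp <|
    liftTL 0 (2 + 1) excMatrix
      (by
        intro i
        rcases i.eq_one_or_two with h | h <;> simp [excMatrix, h] <;> ext a b <;>
          fin_cases a <;> fin_cases b <;> simp)
      (by
        intro i j hij
        rcases i.eq_one_or_two with h | h <;> rcases j.eq_one_or_two with h' | h' <;>
          first
          | omega
          | simp [excMatrix, h, h']
            try (ext a; fin_cases a <;> rfl))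
      (by
        intro i j hij
        have := i.eq_one_or_two
        have := j.eq_one_or_two
        omega)

/-- The module of `excRep`. -/
def ExcModule : Type := Fin 3 → ℂ

instance : AddCommGroup ExcModule := inferInstanceAs (AddCommGroup (Fin 3 → ℂ))

instance : Module ℂ ExcModule := inferInstanceAs (Module ℂ (Fin 3 → ℂ))

instance : Module (TL 0 (2 + 1)) ExcModule := Module.compHom (Fin 3 → ℂ) excRep.toRingHom

instance : IsScalarTower ℂ (TL 0 (2 + 1)) ExcModule where
  smul_assoc c a x := by
    change excRep (c • a) (show Fin 3 → ℂ from x) = c • excRep a (show Fin 3 → ℂ from x)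
    rw [map_smul]; rfl

/-- The standard basis of `ExcModule`. -/
def ExcModule.basis : Module.Basis (Fin 3) ℂ ExcModule := Pi.basisFun ℂ (Fin 3)

theorem u_smul_excModule (i : Gen (2 + 1)) (x : ExcModule) :
    u 0 (2 + 1) i • x = (show ExcModule from (excMatrix i).mulVec x) := by
  change excRep (u 0 (2 + 1) i) x = _
  rw [excRep, AlgHom.comp_apply, liftTL_u]
  rfl

theorem ExcModule.basis_apply (k : Fin 3) :
    ExcModule.basis k = (show ExcModule from (Pi.single k 1 : Fin 3 → ℂ)) :=
  Pi.basisFun_apply ℂ _ k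

theorem u_smul_excModule_basis (i : Gen (2 + 1)) (k : Fin 3) :
    u 0 (2 + 1) i • ExcModule.basis k = (show ExcModule from (excMatrix i).col k) := by
  rw [u_smul_excModule, ExcModule.basis_apply]
  exact Matrix.mulVec_single_one _ _

theorem u_one_smul_basis_zero (h : 1 ≤ 1 ∧ 1 < 2 + 1) :
    u 0 (2 + 1) ⟨1, h⟩ • ExcModule.basis 0 = 0 := by
  rw [u_smul_excModule_basis]
  funext k
  fin_cases k <;> rfl

theorem u_two_smul_basis_zero (h : 1 ≤ 2 ∧ 2 < 2 + 1) :
    u 0 (2 + 1) ⟨2, h⟩ • ExcModule.basis 0 = ExcModule.basis 1 := by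
  rw [u_smul_excModule_basis, ExcModule.basis_apply]
  funext k
  fin_cases k <;> rfl

theorem u_one_smul_basis_one (h : 1 ≤ 1 ∧ 1 < 2 + 1) :
    u 0 (2 + 1) ⟨1, h⟩ • ExcModule.basis 1 = ExcModule.basis 2 := by
  rw [u_smul_excModule_basis, ExcModule.basis_apply]
  funext k
  fin_cases k <;> rfl

/-- The linear map from `V_{2,1}` to `ExcModule` that sends the arc to the first basis vector. -/
def excMap : StdModule 0 2 1 →ₗ[ℂ] ExcModule :=
  (StdModule.basis 0 2 1).constr ℂ fun _ => ExcModule.basis 0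

theorem excMap_toStd (d : LinkState 2 1) : excMap (d.toStd 0) = ExcModule.basis 0 := by
  rw [← StdModule.basis_apply]
  exact (StdModule.basis 0 2 1).constr_basis ℂ _ d

/-- The only generator of `TL_2` is `u_1`, which kills the arc because `β = 0`; correspondingly the
matrix of `u_1` has first column zero. -/
theorem excMap_smul (a : TL 0 2) (x : StdModule 0 2 1) :
    excMap (a • x) = incl 0 2 a • excMap x := by
  refine StdModule.map_smul_of_gen (incl 0 2) excMap (fun i d => ?_) a x
  obtain ⟨i, hi1, hi2⟩ := i
  obtain rfl : i = 1 := by omega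
  obtain rfl := d.eq_arc
  rw [u_smul_toStd_loop 0 _ arc (by simp [arc]), zero_smul, map_zero, incl_u, excMap_toStd]
  exact (u_one_smul_basis_zero _).symm

/-- The elements `1 ⊗ d`, `u_2 ⊗ d`, `u_1 u_2 ⊗ d` of `Ind V_{2,1}`. -/
def excElement (k : Fin 3) : Ind 0 2 1 :=
  Induced.tmul (incl 0 2)
    (![1, u 0 (2 + 1) ⟨2, by decide⟩, u 0 (2 + 1) ⟨1, by decide⟩ * u 0 (2 + 1) ⟨2, by decide⟩] k) (arc.toStd 0)

theorem lift_excElement (k : Fin 3) :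
    Induced.lift (incl 0 2) excMap excMap_smul (excElement k) = ExcModule.basis k := by
  rw [excElement, Induced.lift_tmul, excMap_toStd]
  fin_cases k
  · exact one_smul _ _
  · exact u_two_smul_basis_zero _
  · refine (mul_smul _ _ _).trans ?_
    rw [u_two_smul_basis_zero]
    exact u_one_smul_basis_one _

theorem linearIndependent_excElement : LinearIndependent ℂ excElement := by
  refine LinearIndependent.of_comp
    ((Induced.lift (incl 0 2) excMap excMap_smul).restrictScalars ℂ) ?_
  convert ExcModule.basis.linearIndependent using 1
  funext k
  exact lift_excElement k

/-- As `V_{2,1}` is spanned by the arc, the three chains `1`, `u_2`, `u_1 u_2` applied to it already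
span; no reduction to admissible states is needed. -/
theorem span_excElement : Submodule.span ℂ (Set.range excElement) = ⊤ := by
  rw [eq_top_iff, ← Induced.span_uChain_tmul, Submodule.span_le]
  rintro _ ⟨r, hr, z, hrn, rfl⟩
  rw [SetLike.mem_coe, ← Induced.tmulHom_apply,
    ← Submodule.mem_comap (f := Induced.tmulHom (incl 0 2) (StdModule 0 2 1) (uChain 0 2 r hr))]
  revert z
  rw [← Submodule.eq_top_iff', eq_top_iff, ← (StdModule.basis 0 2 1).span_eq, Submodule.span_le]
  rintro _ ⟨d, rfl⟩
  rw [StdModule.basis_apply, SetLike.mem_coe, Submodule.mem_comap, d.eq_arc]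
  have e3 : uChain 0 2 3 (by omega) = 1 := uChain_top 0 2 _
  have e2 : uChain 0 2 2 (by omega) = u 0 (2 + 1) ⟨2, by decide⟩ := by
    rw [uChain_step 0 2 2 _ (by omega), e3, mul_one]
  have e1 : uChain 0 2 1 (by omega) = u 0 (2 + 1) ⟨1, by decide⟩ * u 0 (2 + 1) ⟨2, by decide⟩ := by
    rw [uChain_step 0 2 1 _ (by omega), e2]
  obtain rfl | rfl | rfl : r = 1 ∨ r = 2 ∨ r = 3 := by omega
  · rw [e1]; exact Submodule.subset_span ⟨2, rfl⟩
  · rw [e2]; exact Submodule.subset_span ⟨1, rfl⟩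
  · rw [e3]; exact Submodule.subset_span ⟨0, rfl⟩

end TemperleyLieb

end

theorem mainTheorem8 :
    -- (i) generic case: `S_{n,p}` is a basis of `Ind V_{n,p}`
    (∀ (β : ℂ) (n p : ℕ), 1 ≤ n → p ≤ n / 2 → ((n, p) ≠ (2, 1) ∨ β ≠ 0) →
      ∃ b : Module.Basis (TemperleyLieb.AdmissiblePair n p) ℂ (TemperleyLieb.Ind β n p),
        ∀ x, b x = TemperleyLieb.admissibleElement β x) ∧
    -- (i) exceptional case: `{1 ⊗ d, u_2 ⊗ d, u_1 u_2 ⊗ d}` is a basis of `Ind V_{2,1}` at `β = 0`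
    (∃ b : Module.Basis (Fin 3) ℂ (TemperleyLieb.Ind 0 2 1),
      b 0 = TemperleyLieb.Induced.tmul (TemperleyLieb.incl 0 2) 1
        (TemperleyLieb.arc.toStd 0) ∧
      b 1 = TemperleyLieb.Induced.tmul (TemperleyLieb.incl 0 2)
        (TemperleyLieb.u 0 3 ⟨2, by decide⟩) (TemperleyLieb.arc.toStd 0) ∧
      b 2 = TemperleyLieb.Induced.tmul (TemperleyLieb.incl 0 2)
        (TemperleyLieb.u 0 3 ⟨1, by decide⟩ * TemperleyLieb.u 0 3 ⟨2, by decide⟩)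
        (TemperleyLieb.arc.toStd 0)) ∧
    -- (ii) `Ind V_{n,p} ≅ Res V_{n+2,p+1}` as modules over `TL_{n+1}`
    (∀ (β : ℂ) (n p : ℕ), 1 ≤ n → p ≤ n / 2 → ((n, p) ≠ (2, 1) ∨ β ≠ 0) →
      Nonempty (TemperleyLieb.Ind β n p ≃ₗ[TemperleyLieb.TL β (n + 1)]
        TemperleyLieb.Res β n (p + 1))) ∧
    -- exact sequence `0 → V_{n+1,p+1} → Ind V_{n,p} → V_{n+1,p} → 0` of `TL_{n+1}`-modules
    (∀ (β : ℂ) (n p : ℕ), 1 ≤ n → p ≤ n / 2 → ((n, p) ≠ (2, 1) ∨ β ≠ 0) →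
      ∃ (f : TemperleyLieb.StdModule β (n + 1) (p + 1) →ₗ[TemperleyLieb.TL β (n + 1)]
          TemperleyLieb.Ind β n p)
        (g : TemperleyLieb.Ind β n p →ₗ[TemperleyLieb.TL β (n + 1)]
          TemperleyLieb.StdModule β (n + 1) p),
        Function.Injective f ∧ Function.Exact f g ∧ Function.Surjective g) := by
  refine ⟨fun β n p _ hp h => ?_, ?_, fun β n p _ hp h => ?_, fun β n p _ hp h => ?_⟩
  · exact ⟨TemperleyLieb.Ind.basis hp h, TemperleyLieb.Ind.basis_apply hp h⟩
  · have hb := Module.Basis.mk_apply TemperleyLieb.linearIndependent_excElement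
      TemperleyLieb.span_excElement.ge
    exact ⟨Module.Basis.mk TemperleyLieb.linearIndependent_excElement
      TemperleyLieb.span_excElement.ge, hb 0, hb 1, hb 2⟩
  · exact ⟨TemperleyLieb.indEquivRes hp h⟩
  · obtain ⟨f, g, hf, hfg, hg⟩ := TemperleyLieb.exists_exact_res β (n := n) hp
    let e := TemperleyLieb.indEquivRes hp h
    refine ⟨e.symm.toLinearMap ∘ₗ f, g ∘ₗ e.toLinearMap, e.symm.injective.comp hf, fun x => ?_,
      hg.comp e.surjective⟩
    -- Exactness is transported along `e`: the conditions `f y = e x` and `e.symm (f y) = x` are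
    -- equivalent.
    refine (hfg (e x)).trans (exists_congr fun y => ?_)
    exact e.symm_apply_eq.symm
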